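/- **Definitions.** Let $\mathcal A$ be a finite alphabet, and give $\mathcal A^{\mathbb Z}$ the product topology and the left shift $\sigma$. A *subshift* is a closed, shift-invariant set $X\subset\mathcal A^{\mathbb Z}$. It is *transitive* if it is the closure of the orbit $\{\sigma^n x : n\in\mathbb Z\}$ of one of its points, and *minimal* if it is the closure of the orbit of each of its points. It is *the orbit closure of a one-sided sequence* $y\in\mathcal A^{\mathbb N}$ if it is minimal and is the closure of the orbit of some $x\in X$ that contains $y$. Let $p(q)$ be the number of words of length $q$ that appear in points of $X$. The subshift is *uniquely ergodic* if it carries exactly one $\sigma$-invariant Borel probability measure. An invariant probability measure $\mu$ is *weak mixing* if every measurable $f:X\to\mathbb C$ with $f\circ\sigma=\lambda f$ $\mu$-almost everywhere, for some $\lambda\in\mathbb C$, is $\mu$-almost everywhere constant. For positive integers $m<n$ let $\tau_{m,n}$ be the substitution $0\mapsto 0^{m-1}1$, $1\mapsto 0^{n-1}1$ on $\{0,1\}$. Substitutions are composed by extending them to words by concatenation. **Theorem.** There is a subshift $X\subset\{0,1\}^{\mathbb Z}$ that is infinite, transitive and uniquely ergodic, whose unique invariant probability measure is weak mixing, and for which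 $$\limsup_{q\to\infty}\frac{p(q)}{q}=\frac32 .$$ Moreover, $X$ can be taken of the following form. There are integers $1=m_1<m_2<m_3<\cdots$ with $\sum_{k} 1/m_k<\infty$ such that, with $n_k=2m_k$ and $\rho_k=\tau_{m_1,n_1}\circ\cdots\circ\tau_{m_k,n_k}$, the height $d_k=|\rho_k(0)|$ is prime for every $k\ge 2$, the words $\rho_k(0)$ converge to a right-infinite sequence $y=\lim_k\rho_k(0)$, and $X$ is the orbit closure of $y$ (in particular, $X$ is minimal). -/

import Mathlib

open SymbolicDynamics.FullShift Filter MeasureTheory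

namespace LowComplexity

section Subshifts

variable {A : Type*} [TopologicalSpace A]

/-- The closure, in the product topology on `A^ℤ`, of the two-sided orbit of `x` under the left
shift. -/
def orbitClosure (x : ℤ → A) : Set (ℤ → A) :=
  closure (Set.range fun n : ℤ => shift n x)

/-- A subshift is transitive if it is the orbit closure of one of its points. -/
def IsTransitive (X : Subshift A ℤ) : Prop :=
  ∃ x ∈ X.carrier, X.carrier = orbitClosure x

/-- A subshift is minimal if it is the orbit closure of each of its points. -/
def IsMinimal (X : Subshift A ℤ) : Prop :=
  ∀ x ∈ X.carrier, X.carrier = orbitClosure x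

/-- `X` is the orbit closure of the one-sided sequence `y`: the subshift `X` is minimal, and it is
the orbit closure of some two-sided sequence `x ∈ X` that contains `y`. -/
def IsOrbitClosureOfOneSided (X : Subshift A ℤ) (y : ℕ → A) : Prop :=
  IsMinimal X ∧ ∃ x ∈ X.carrier,
    (∃ j : ℤ, ∀ i : ℕ, x (j + i) = y i) ∧ X.carrier = orbitClosure x

/-- The words of length `n` that appear in points of `X`. -/
def languageOfLength (X : Subshift A ℤ) (n : ℕ) : Set (Fin n → A) :=
  {w | ∃ x ∈ X.carrier, ∃ i : ℤ, ∀ j : Fin n, x (i + (j : ℕ)) = w j}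

/-- The word complexity function `p` of `X` (the alphabets in use are finite). -/
noncomputable def complexity (X : Subshift A ℤ) (n : ℕ) : ℕ :=
  (languageOfLength X n).ncard

/-- The left shift, as a map of the subshift `X` to itself. -/
def shiftMap (X : Subshift A ℤ) : X.carrier → X.carrier :=
  (X.mapsTo 1).restrict (shift (1 : ℤ)) X.carrier X.carrier

/-- Shift-invariant probability measures on `X`. For a finite alphabet, the σ-algebra on `X` (which
is induced by the product σ-algebra) is the Borel σ-algebra. -/
def IsInvariantProbability [MeasurableSpace A] (X : Subshift A ℤ)
    (μ : Measure X.carrier) : Prop :=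
  IsProbabilityMeasure μ ∧ MeasurePreserving (shiftMap X) μ μ

end Subshifts

/-- Weak mixing: the only measurable eigenfunctions of `T` are the almost everywhere constant
functions. -/
def IsWeakMixing {Ω : Type*} [MeasurableSpace Ω] (T : Ω → Ω) (μ : Measure Ω) : Prop :=
  ∀ (c : ℂ) (f : Ω → ℂ), AEStronglyMeasurable f μ →
    (∀ᵐ x ∂μ, f (T x) = c * f x) → ∃ z : ℂ, ∀ᵐ x ∂μ, f x = z

section Substitutions

/-- The composition `ρ ∘ τ` of two substitutions, where `ρ` is extended to words by
concatenation. -/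
def substComp {A B C : Type*} (ρ : B → List C) (τ : A → List B) : A → List C :=
  fun a => (τ a).flatMap ρ

/-- The substitution `0 ↦ 0^(m-1) 1`, `1 ↦ 0^(n-1) 1`, for positive `m` and `n`. -/
def tau (m n : ℕ) : Fin 2 → List (Fin 2) :=
  ![List.replicate (m - 1) 0 ++ [1], List.replicate (n - 1) 0 ++ [1]]

/-- The composition of `tau (m 1) (n 1)`, …, `tau (m k) (n k)`, in this order from the outside to
the inside; it is the identity substitution for `k = 0`. The values `m 0` and `n 0` are not
used. -/
def rho (m n : ℕ → ℕ) : ℕ → Fin 2 → List (Fin 2)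
  | 0 => fun a => [a]
  | k + 1 => substComp (rho m n k) (tau (m (k + 1)) (n (k + 1)))

/-- The right-infinite sequence `y` is the limit of the finite words `w k` as `k → ∞`. -/
def IsLimitOfWords {A : Type*} (w : ℕ → List A) (y : ℕ → A) : Prop :=
  ∀ i : ℕ, ∀ᶠ k in atTop, (w k)[i]? = some (y i)

end Substitutions

end LowComplexity

/-! Write u_k, v_k for `zeroWord m k`, `oneWord m k`, and d_k for the length of u_k. Then u_{k+1} =
u_k^(m-1) v_k and v_{k+1} = u_k^m u_{k+1} with m = m_{k+1}. The subshift consists of the two-sided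
sequences whose words all occur in y = lim u_k. It is minimal because u_k ends both blocks of level
k and so recurs with bounded gaps.

Complexity. Below, the increments of p count right special words: a long power of u_k keeps the
period d_k up to a known place, and this gives right special words up to length about 2 m_{k+1} d_k.
One exists for every length, and between about m_{k+1} d_k and 2 m_{k+1} d_k those of levels k and
k+1 are distinct. Hence p(q) is at least about 3/2 q near q = 2 m_{k+1} d_k (`complexity_add_two`,
`le_complexity_specialLength`). Above, y is a string of pulses u_k^m separated by the runs u^M or
u^(2M) with u = u_{k+1} and M = m_{k+2}. A factor shorter than a long run sees at most two pulses,
and counting such windows yields `complexity_le`.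

Measure. Twisted Birkhoff sums of cylinder functions, with weights c^i and |c| = 1, are additive on
words up to bounded errors. Passing from u_k to u_{k+1} multiplies the sum by a geometric sum in
c^(d_k), up to relative errors that are summable because of the growth of m. For c = 1 the averages
converge. For c ≠ 1 they tend to 0: otherwise the geometric sums are asymptotically maximal, d_{k+2}
= m_{k+2} d_{k+1} + m_{k+1} d_k forces c^(d_k) = 1 for large k, and two distinct prime heights give
c = 1 (`eq_one_of_geom_sum_large`). These limits are uniform, and integrating them against an
eigenfunction gives both unique ergodicity and weak mixing (`exists_setIntegral_eq`). The prime
heights come from Dirichlet's theorem. -/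

namespace LowComplexity

/-! ### Words, powers and concatenations of blocks. -/

section Words

variable {A : Type*}

/-- The word `w` repeated `j` times. -/
def wordPow (w : List A) (j : ℕ) : List A := (List.replicate j w).flatten

@[simp] lemma wordPow_zero (w : List A) : wordPow w 0 = [] := by simp [wordPow]

lemma wordPow_succ (w : List A) (j : ℕ) : wordPow w (j + 1) = w ++ wordPow w j := by
  simp [wordPow, List.replicate_succ]

@[simp] lemma length_wordPow (w : List A) (j : ℕ) : (wordPow w j).length = j * w.length := by
  simp [wordPow]

lemma wordPow_add (w : List A) (i j : ℕ) : wordPow w (i + j) = wordPow w i ++ wordPow w j := by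
  simp [wordPow, ← List.replicate_append_replicate]

lemma wordPow_succ' (w : List A) (j : ℕ) : wordPow w (j + 1) = wordPow w j ++ w := by
  rw [wordPow_add, wordPow_succ]; simp

/-- The finite word `w` occurs in the one-sided sequence `y` at position `i`. -/
def OccursAt (y : ℕ → A) (w : List A) (i : ℕ) : Prop :=
  ∀ j < w.length, w[j]? = some (y (i + j))

lemma occursAt_nil (y : ℕ → A) (i : ℕ) : OccursAt y [] i := by simp [OccursAt]

lemma occursAt_append {y : ℕ → A} {w w' : List A} {i : ℕ} :
    OccursAt y (w ++ w') i ↔ OccursAt y w i ∧ OccursAt y w' (i + w.length) := by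
  constructor
  · intro h
    refine ⟨fun j hj => ?_, fun j hj => ?_⟩
    · have := h j (by simp; omega)
      rwa [List.getElem?_append_left hj] at this
    · have := h (w.length + j) (by simp; omega)
      rw [List.getElem?_append_right (by omega)] at this
      simpa [add_assoc] using this
  · rintro ⟨h, h'⟩ j hj
    rcases lt_or_ge j w.length with hl | hl
    · rw [List.getElem?_append_left hl]; exact h j hl
    · rw [List.getElem?_append_right hl, h' (j - w.length) (by simp at hj; omega)]
      congr 2; omega

lemma OccursAt.prefix {y : ℕ → A} {w w' : List A} {i : ℕ} (h : OccursAt y w i) (hw : w' <+: w) :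
    OccursAt y w' i := by
  obtain ⟨t, rfl⟩ := hw
  exact (occursAt_append.1 h).1

lemma occursAt_wordPow {y : ℕ → A} {w : List A} {i j : ℕ} :
    OccursAt y (wordPow w j) i ↔ ∀ l < j, OccursAt y w (i + l * w.length) := by
  induction j with
  | zero => simp [occursAt_nil]
  | succ j ih =>
    rw [wordPow_succ', occursAt_append, ih, length_wordPow]
    constructor
    · rintro ⟨h, h'⟩ l hl
      rcases Nat.lt_succ_iff_lt_or_eq.1 hl with h1 | rfl
      · exact h l h1
      · exact h'
    · intro h
      exact ⟨fun l hl => h l (by omega), h j (by omega)⟩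

/-- A power of `w` is read off by taking remainders modulo the length of `w`. -/
lemma OccursAt.wordPow_getElem? {y : ℕ → A} {w : List A} {i j : ℕ} (h : OccursAt y (wordPow w j) i)
    {t : ℕ} (ht : t < j * w.length) : w[t % w.length]? = some (y (i + t)) := by
  have hw : 0 < w.length := Nat.pos_of_ne_zero (by rintro h0; simp [h0] at ht)
  have h1 : t / w.length < j := by rwa [Nat.div_lt_iff_lt_mul hw]
  have := occursAt_wordPow.1 h _ h1 (t % w.length) (Nat.mod_lt _ hw)
  rw [this, add_assoc, mul_comm, Nat.div_add_mod]

/-- Every position of a concatenation of nonempty blocks lies in one of the blocks. -/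
lemma exists_block {B : Type*} (ρ : B → List A) (s : List B) (i : ℕ)
    (hi : i < (s.flatMap ρ).length) :
    ∃ s₁ a s₂, s = s₁ ++ a :: s₂ ∧ (s₁.flatMap ρ).length ≤ i ∧
      i < (s₁.flatMap ρ).length + (ρ a).length := by
  induction s generalizing i with
  | nil => simp at hi
  | cons b s ih =>
    rcases lt_or_ge i (ρ b).length with h | h
    · exact ⟨[], b, s, by simp, by simp, by simpa⟩
    · obtain ⟨s₁, a, s₂, rfl, h1, h2⟩ := ih (i - (ρ b).length) (by
        rw [List.flatMap_cons, List.length_append] at hi; omega)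
      refine ⟨b :: s₁, a, s₂, rfl, ?_, ?_⟩ <;>
        rw [List.flatMap_cons, List.length_append] <;> omega

lemma length_flatMap_le {B : Type*} (ρ : B → List A) (E : ℕ) (hE : ∀ b, (ρ b).length ≤ E)
    (s : List B) : (s.flatMap ρ).length ≤ s.length * E := by
  induction s with
  | nil => simp
  | cons b s ih =>
    rw [List.flatMap_cons, List.length_append, List.length_cons, Nat.succ_mul]
    have := hE b; omega

lemma exists_prefix_flatMap {B : Type*} (ρ : B → List A) (E : ℕ) (hE : ∀ b, (ρ b).length ≤ E)
    (s : List B) (w : List A) (hw : w <+: s.flatMap ρ) :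
    ∃ (s' : List B) (b : List A), w = s'.flatMap ρ ++ b ∧ b.length ≤ E := by
  induction s generalizing w with
  | nil => exact ⟨[], [], by simpa using hw, by simp⟩
  | cons a s ih =>
    obtain ⟨r, hr⟩ := hw
    rw [List.flatMap_cons, List.append_eq_append_iff] at hr
    rcases hr with ⟨q, h1, -⟩ | ⟨q, h1, h2⟩
    · refine ⟨[], w, by simp, ?_⟩
      have := congrArg List.length h1
      have h3 := hE a
      simp at this
      omega
    · obtain ⟨s', b, h3, hb⟩ := ih q ⟨r, h2.symm⟩
      exact ⟨a :: s', b, by rw [h1, h3, List.flatMap_cons, List.append_assoc], hb⟩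

/-- A factor of a concatenation of blocks is a concatenation of blocks, up to two short words. -/
lemma exists_infix_flatMap {B : Type*} (ρ : B → List A) (E : ℕ) (hE : ∀ b, (ρ b).length ≤ E)
    (s : List B) (w : List A) (hw : w <:+: s.flatMap ρ) :
    ∃ (a : List A) (s' : List B) (b : List A), w = a ++ s'.flatMap ρ ++ b ∧ a.length ≤ E ∧ b.length ≤ E := by
  obtain ⟨p, t, h⟩ := hw
  induction s generalizing p with
  | nil =>
    refine ⟨[], [], [], ?_, by simp, by simp⟩
    simp at h
    simp [h]
  | cons c s ih =>
    rw [List.flatMap_cons, List.append_assoc, List.append_eq_append_iff] at h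
    rcases h with ⟨p', h1, h2⟩ | ⟨p', h1, h2⟩
    · rw [List.append_eq_append_iff] at h2
      rcases h2 with ⟨a', h3, h4⟩ | ⟨a', h3, h4⟩
      · refine ⟨w, [], [], by simp, ?_, by simp⟩
        have := congrArg List.length h1
        have h5 := congrArg List.length h3
        simp at this h5
        have := hE c
        omega
      · obtain ⟨s', b, h6, hb⟩ := exists_prefix_flatMap ρ E hE s a' ⟨t, h4.symm⟩
        refine ⟨p', s', b, by rw [h3, h6, List.append_assoc], ?_, hb⟩
        have := congrArg List.length h1
        simp at this
        have := hE c
        omega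
    · exact ih p' (by rw [h2, List.append_assoc])

end Words

/-! ### The words of the construction and their limit. -/

section Substitution

/-- The image of `0` under the `k`-th composed substitution with parameters `m` and `2 * m`. -/
def zeroWord (m : ℕ → ℕ) (k : ℕ) : List (Fin 2) := rho m (fun k => 2 * m k) k 0

/-- The image of `1` under the `k`-th composed substitution with parameters `m` and `2 * m`. -/
def oneWord (m : ℕ → ℕ) (k : ℕ) : List (Fin 2) := rho m (fun k => 2 * m k) k 1

/-- The height of the `k`-th tower. -/
def height (m : ℕ → ℕ) (k : ℕ) : ℕ := (zeroWord m k).length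

/-- Sequences of parameters that start with `1`, grow fast, and produce prime heights. -/
structure Admissible (m : ℕ → ℕ) : Prop where
  one : m 1 = 1
  large : ∀ k, 2 ≤ k → 2 ^ (k + 1) ≤ m k
  prime : ∀ k, 2 ≤ k → (height m k).Prime

variable {m : ℕ → ℕ}

lemma Admissible.pos (hm : Admissible m) (k : ℕ) : 1 ≤ m (k + 1) := by
  rcases Nat.eq_zero_or_pos k with rfl | hk
  · exact hm.one.ge
  · exact Nat.one_le_two_pow.trans (hm.large (k + 1) (by omega))

lemma Admissible.eight_le (hm : Admissible m) {k : ℕ} (hk : 2 ≤ k) : 8 ≤ m k := by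
  have h1 := hm.large k hk
  have h2 : 2 ^ 3 ≤ 2 ^ (k + 1) := Nat.pow_le_pow_right (by norm_num) (by omega)
  omega

lemma flatMap_replicate_append {A B : Type*} (ρ : B → List A) (a b : B) (j : ℕ) :
    (List.replicate j a ++ [b]).flatMap ρ = wordPow (ρ a) j ++ ρ b := by
  simp [wordPow, List.flatMap_def]

@[simp] lemma zeroWord_zero : zeroWord m 0 = [0] := rfl

@[simp] lemma oneWord_zero : oneWord m 0 = [1] := rfl

lemma zeroWord_succ (k : ℕ) :
    zeroWord m (k + 1) = wordPow (zeroWord m k) (m (k + 1) - 1) ++ oneWord m k := by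
  simp only [zeroWord, oneWord, rho, substComp, tau]
  exact flatMap_replicate_append _ _ _ _

lemma oneWord_succ (k : ℕ) :
    oneWord m (k + 1) = wordPow (zeroWord m k) (2 * m (k + 1) - 1) ++ oneWord m k := by
  simp only [zeroWord, oneWord, rho, substComp, tau]
  exact flatMap_replicate_append _ _ _ _

lemma oneWord_succ_eq (hm : Admissible m) (k : ℕ) :
    oneWord m (k + 1) = wordPow (zeroWord m k) (m (k + 1)) ++ zeroWord m (k + 1) := by
  have := hm.pos k
  rw [oneWord_succ, zeroWord_succ, ← List.append_assoc, ← wordPow_add]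
  congr 2; omega

lemma height_succ (k : ℕ) :
    height m (k + 1) = (m (k + 1) - 1) * height m k + (oneWord m k).length := by
  simp [height, zeroWord_succ]

lemma length_oneWord_succ (hm : Admissible m) (k : ℕ) :
    (oneWord m (k + 1)).length = m (k + 1) * height m k + height m (k + 1) := by
  simp [height, oneWord_succ_eq hm]

lemma height_le_length_oneWord (hm : Admissible m) (k : ℕ) :
    height m k ≤ (oneWord m k).length := by
  cases k with
  | zero => simp [height]
  | succ k => rw [length_oneWord_succ hm]; omega

lemma mul_height_le (hm : Admissible m) (k : ℕ) :
    m (k + 1) * height m k ≤ height m (k + 1) := by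
  have h1 := height_le_length_oneWord hm k
  have h2 := hm.pos k
  rw [height_succ]
  obtain ⟨a, ha⟩ := Nat.exists_eq_add_of_le' h2
  rw [ha, Nat.add_sub_cancel, Nat.succ_mul]; omega

lemma length_oneWord_le (hm : Admissible m) (k : ℕ) :
    (oneWord m k).length ≤ 2 * height m k := by
  cases k with
  | zero => simp [height]
  | succ k => rw [length_oneWord_succ hm]; have := mul_height_le hm k; omega

lemma height_succ_le (hm : Admissible m) (k : ℕ) :
    height m (k + 1) ≤ m (k + 1) * height m k + height m k := by
  have h1 := length_oneWord_le hm k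
  have h2 := hm.pos k
  rw [height_succ]
  obtain ⟨a, ha⟩ := Nat.exists_eq_add_of_le' h2
  rw [ha, Nat.add_sub_cancel, Nat.succ_mul]; omega

lemma height_pos (hm : Admissible m) (k : ℕ) : 0 < height m k := by
  induction k with
  | zero => simp [height]
  | succ k ih => exact lt_of_lt_of_le (Nat.mul_pos (hm.pos k) ih) (mul_height_le hm k)

lemma height_mono (hm : Admissible m) : Monotone (height m) :=
  monotone_nat_of_le_succ fun k =>
    (Nat.le_mul_of_pos_left _ (hm.pos k)).trans (mul_height_le hm k)

lemma two_pow_le_height (hm : Admissible m) (k : ℕ) : 2 ^ k ≤ height m (k + 1) := by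
  induction k with
  | zero => exact height_pos hm 1
  | succ k ih =>
    have h1 := mul_height_le hm (k + 1)
    have h2 := hm.eight_le (k := k + 1 + 1) (by omega)
    have h3 := Nat.mul_le_mul_right (height m (k + 1)) h2
    rw [pow_succ]; omega

/-- Hence the letter that `limitSeq` reads exists, and its default value never matters. -/
lemma lt_height (hm : Admissible m) (k : ℕ) : k < height m (k + 1) :=
  (Nat.lt_two_pow_self).trans_le (two_pow_le_height hm k)

lemma length_rho_le (hm : Admissible m) (k : ℕ) (a : Fin 2) :
    (rho m (fun k => 2 * m k) k a).length ≤ 2 * height m k := by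
  fin_cases a
  · show height m k ≤ _; omega
  · exact length_oneWord_le hm k

lemma height_le_length_rho (hm : Admissible m) (k : ℕ) (a : Fin 2) :
    height m k ≤ (rho m (fun k => 2 * m k) k a).length := by
  fin_cases a
  · exact le_rfl
  · exact height_le_length_oneWord hm k

/-- Level 0 is excluded: since m 1 = 1, the words of levels 0 and 1 are `[0]` and `[1]`. -/
lemma zeroWord_prefix_succ (hm : Admissible m) {k : ℕ} (hk : 1 ≤ k) :
    zeroWord m k <+: zeroWord m (k + 1) := by
  have := hm.eight_le (k := k + 1) (by omega)
  obtain ⟨a, ha⟩ := Nat.exists_eq_add_of_le' this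
  rw [zeroWord_succ, ha, show a + 8 - 1 = a + 6 + 1 by omega, wordPow_succ, List.append_assoc]
  exact List.prefix_append _ _

lemma zeroWord_prefix (hm : Admissible m) {k l : ℕ} (hk : 1 ≤ k) (hl : k ≤ l) :
    zeroWord m k <+: zeroWord m l := by
  induction l, hl using Nat.le_induction with
  | base => exact List.prefix_rfl
  | succ l hl ih => exact ih.trans (zeroWord_prefix_succ hm (by omega))

lemma getElem?_of_prefix {A : Type*} {w w' : List A} (h : w <+: w') {j : ℕ} (hj : j < w.length) :
    w'[j]? = w[j]? := by
  obtain ⟨t, rfl⟩ := h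
  exact List.getElem?_append_left hj

/-- The right-infinite limit of the words `zeroWord m k`. -/
def limitSeq (m : ℕ → ℕ) (i : ℕ) : Fin 2 := (zeroWord m (i + 1)).getD i 0

lemma occursAt_zeroWord_zero (hm : Admissible m) {k : ℕ} (hk : 1 ≤ k) :
    OccursAt (limitSeq m) (zeroWord m k) 0 := by
  intro j hj
  have hj' : j < (zeroWord m (j + 1)).length := lt_height hm j
  have h1 := getElem?_of_prefix (zeroWord_prefix hm hk (le_max_left k (j + 1))) hj
  have h2 := getElem?_of_prefix (zeroWord_prefix hm (by omega : 1 ≤ j + 1)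
    (le_max_right k (j + 1))) hj'
  rw [zero_add, limitSeq, List.getD_eq_getElem _ _ hj', ← List.getElem?_eq_getElem hj', ← h2, h1]

lemma isLimitOfWords_limitSeq (hm : Admissible m) :
    IsLimitOfWords (fun k => zeroWord m k) (limitSeq m) := by
  intro i
  filter_upwards [eventually_ge_atTop (i + 1)] with k hk
  have := occursAt_zeroWord_zero hm (k := k) (by omega) i
    ((lt_height hm i).trans_le (height_mono hm hk))
  simpa using this

lemma rho_eq_flatMap {m n : ℕ → ℕ} {k l : ℕ} (h : k ≤ l) :
    ∃ s : Fin 2 → List (Fin 2), ∀ a, rho m n l a = (s a).flatMap (rho m n k) := by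
  induction l, h using Nat.le_induction with
  | base => exact ⟨fun a => [a], fun a => by simp⟩
  | succ l hl ih =>
    obtain ⟨s, hs⟩ := ih
    refine ⟨fun a => (tau (m (l + 1)) (n (l + 1)) a).flatMap s, fun a => ?_⟩
    rw [List.flatMap_assoc]
    simp only [rho, substComp, ← hs]

/-- Around each position, the limit sequence is a concatenation of blocks of level `k`. -/
lemma exists_blocks (hm : Admissible m) (k i N : ℕ) :
    ∃ s₁ a s₂, OccursAt (limitSeq m) ((s₁ ++ a :: s₂).flatMap (rho m (fun k => 2 * m k) k)) 0 ∧
      (s₁.flatMap (rho m (fun k => 2 * m k) k)).length ≤ i ∧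
      i < (s₁.flatMap (rho m (fun k => 2 * m k) k)).length +
        (rho m (fun k => 2 * m k) k a).length ∧ N ≤ s₂.length := by
  set ρ := rho m (fun k => 2 * m k) k with hρ
  set E := 2 * height m k
  -- A word longer than this has room, after the block containing `i`, for `N` blocks of length at
  -- most `E`.
  set L := i + E + N * E
  obtain ⟨s, hs⟩ := rho_eq_flatMap (m := m) (n := fun k => 2 * m k)
    (show k ≤ L + k + 1 by omega)
  have hL : L < height m (L + k + 1) := by
    have := lt_height hm (L + k); omega
  have h0 : zeroWord m (L + k + 1) = (s 0).flatMap ρ := hs 0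
  have hlen : ((s 0).flatMap ρ).length = height m (L + k + 1) := by rw [← h0]; rfl
  obtain ⟨s₁, a, s₂, h1, h2, h3⟩ := exists_block ρ (s 0) i (by rw [hlen]; omega)
  refine ⟨s₁, a, s₂, ?_, h2, h3, ?_⟩
  · rw [← h1, ← h0]; exact occursAt_zeroWord_zero hm (by omega)
  · have h4 := length_flatMap_le ρ E (length_rho_le hm k) s₂
    have h5 := length_rho_le hm k a
    rw [h1] at hlen
    simp only [List.flatMap_append, List.flatMap_cons, List.length_append] at hlen
    by_contra hN
    have h6 : s₂.length * E ≤ N * E := Nat.mul_le_mul_right _ (by omega)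
    simp only [← hρ] at h5
    omega

lemma zeroWord_suffix_oneWord (hm : Admissible m) (k : ℕ) :
    zeroWord m (k + 1) <:+ oneWord m (k + 1) := by
  rw [oneWord_succ_eq hm]; exact List.suffix_append _ _

lemma zeroWord_suffix_succ (hm : Admissible m) (k : ℕ) :
    zeroWord m (k + 1) <:+ zeroWord m (k + 2) := by
  rw [zeroWord_succ (k + 1)]
  exact (zeroWord_suffix_oneWord hm k).trans (List.suffix_append _ _)

end Substitution

/-! ### The subshift defined by the factors of a one-sided sequence. -/

section FactorSubshift

variable {A : Type*}

/-- The word of length `q` at position `i` of a one-sided sequence. -/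
def factor (y : ℕ → A) (q i : ℕ) : Fin q → A := fun j => y (i + j)

variable [TopologicalSpace A]

/-- The subshift of the two-sided sequences all of whose finite words are factors of `y`. -/
def factorSubshift [Finite A] [DiscreteTopology A] (y : ℕ → A) : Subshift A ℤ where
  carrier := {x | ∀ (i : ℤ) (n : ℕ), ∃ i' : ℕ, ∀ j < n, x (i + j) = y (i' + j)}
  isClosed := by
    simp only [Set.ofPred_forall]
    refine isClosed_iInter fun i => isClosed_iInter fun n => ?_
    have hc : Continuous fun (x : ℤ → A) (j : Fin n) => x (i + (j : ℕ)) := by fun_prop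
    convert (isClosed_discrete {w : Fin n → A | ∃ i' : ℕ, ∀ j : Fin n, w j = y (i' + j)}).preimage
      hc using 1
    ext x
    constructor
    · rintro ⟨i', h⟩
      exact ⟨i', fun j => h j j.2⟩
    · rintro ⟨i', h⟩
      exact ⟨i', fun j hj => h ⟨j, hj⟩⟩
  mapsTo := by
    intro g x hx i n
    obtain ⟨i', h⟩ := hx (g + i) n
    exact ⟨i', fun j hj => by rw [shift_apply, ← add_assoc, h j hj]⟩

/-- A point lies in the closure of an orbit if all of its central words occur there. -/
lemma mem_orbitClosure_of_forall {x z : ℤ → A}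
    (h : ∀ r : ℕ, ∃ n : ℤ, ∀ j : ℤ, -r ≤ j → j ≤ r → x (n + j) = z j) : z ∈ orbitClosure x := by
  rw [orbitClosure, mem_closure_iff]
  intro o ho hz
  obtain ⟨I, u, hu, hI⟩ := isOpen_pi_iff.1 ho z hz
  obtain ⟨r, hr⟩ : ∃ r : ℕ, ∀ j ∈ I, j.natAbs ≤ r :=
    ⟨I.sup Int.natAbs, fun j hj => Finset.le_sup (f := Int.natAbs) hj⟩
  obtain ⟨n, hn⟩ := h r
  refine ⟨shift n x, hI fun j hj => ?_, n, rfl⟩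
  have := hr j hj
  rw [shift_apply, hn j (by omega) (by omega)]
  exact (hu j hj).2

lemma orbitClosure_subset (X : Subshift A ℤ) {x : ℤ → A} (hx : x ∈ X.carrier) :
    orbitClosure x ⊆ X.carrier :=
  closure_minimal (by rintro _ ⟨n, rfl⟩; exact X.mapsTo n hx) X.isClosed

end FactorSubshift

/-! ### A two-sided extension, uniform recurrence and minimality. -/

section Minimality

variable {m : ℕ → ℕ}

/-- The two-sided sequence that has `limitSeq m` on the right and the limit of the final parts of
the words `zeroWord m k` on the left. -/
def twoSidedSeq (m : ℕ → ℕ) (j : ℤ) : Fin 2 :=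
  if 0 ≤ j then limitSeq m j.toNat else limitSeq m (height m (j.natAbs + 1) - j.natAbs)

lemma occursAt_zeroWord_height (hm : Admissible m) {k : ℕ} (hk : 1 ≤ k) :
    OccursAt (limitSeq m) (zeroWord m k) (height m k) := by
  have h := occursAt_zeroWord_zero hm (k := k + 1) (by omega)
  have := hm.eight_le (k := k + 1) (by omega)
  rw [zeroWord_succ, occursAt_append, occursAt_wordPow] at h
  simpa [height] using h.1 1 (by omega)

lemma zeroWord_suffix (hm : Admissible m) {k l : ℕ} (hk : 1 ≤ k) (hl : k ≤ l) :
    zeroWord m k <:+ zeroWord m l := by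
  induction l, hl using Nat.le_induction with
  | base => exact List.suffix_rfl
  | succ l hl ih =>
    obtain ⟨l, rfl⟩ := Nat.exists_eq_add_of_le' (hk.trans hl)
    exact ih.trans (zeroWord_suffix_succ hm l)

lemma OccursAt.suffix {A : Type*} {y : ℕ → A} {w w' : List A} {i : ℕ} (h : OccursAt y w i)
    (hw : w' <:+ w) : OccursAt y w' (i + w.length - w'.length) := by
  obtain ⟨t, rfl⟩ := hw
  convert (occursAt_append.1 h).2 using 1
  simp only [List.length_append]
  omega

lemma limitSeq_height_sub (hm : Admissible m) {k l t : ℕ} (hk : 1 ≤ k) (hl : k ≤ l) (ht : 1 ≤ t)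
    (htk : t ≤ height m k) :
    limitSeq m (height m l - t) = limitSeq m (height m k - t) := by
  have h1 := (occursAt_zeroWord_zero hm (hk.trans hl)).suffix (zeroWord_suffix hm hk hl)
    (height m k - t) (by unfold height at *; omega)
  have h2 := occursAt_zeroWord_zero hm hk (height m k - t) (by unfold height at *; omega)
  have h3 := height_mono hm hl
  rw [h2, Option.some_inj] at h1
  rw [zero_add] at h1
  rw [h1]
  congr 1
  unfold height at *
  omega

/-- Both sides spell u_k u_k, the word with which y begins. This is why the two-sided sequence has
no words beyond the factors of y. -/
lemma twoSidedSeq_eq (hm : Admissible m) {k : ℕ} (hk : 1 ≤ k) {j : ℤ} (h1 : -(height m k : ℤ) ≤ j)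
    (h2 : j < height m k) : twoSidedSeq m j = limitSeq m (height m k + j).toNat := by
  unfold twoSidedSeq
  split_ifs with hj
  · lift j to ℕ using hj
    have h3 := occursAt_zeroWord_zero hm hk j (by unfold height at *; omega)
    rw [occursAt_zeroWord_height hm hk j (by unfold height at *; omega), Option.some_inj,
      zero_add] at h3
    rw [Int.toNat_natCast, ← h3]
    congr 1
  · have h4 : (height m k + j).toNat = height m k - j.natAbs := by omega
    rw [h4]
    have h5 := lt_height hm j.natAbs
    rcases le_total k (j.natAbs + 1) with h | h
    · exact limitSeq_height_sub hm hk h (by omega) (by omega)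
    · exact (limitSeq_height_sub hm (by omega) h (by omega) (by omega)).symm

lemma twoSidedSeq_natCast (i : ℕ) : twoSidedSeq m i = limitSeq m i := by simp [twoSidedSeq]

lemma twoSidedSeq_mem (hm : Admissible m) :
    twoSidedSeq m ∈ (factorSubshift (limitSeq m)).carrier := by
  intro i n
  set k := i.natAbs + n + 1
  have hk : i.natAbs + n < height m k := lt_height hm _
  refine ⟨(height m k + i).toNat, fun j hj => ?_⟩
  rw [twoSidedSeq_eq hm (k := k) (by omega) (by omega) (by omega)]
  congr 1
  omega

lemma zeroWord_suffix_rho (hm : Admissible m) {k : ℕ} (hk : 1 ≤ k) (a : Fin 2) :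
    zeroWord m k <:+ rho m (fun k => 2 * m k) k a := by
  obtain ⟨k, rfl⟩ := Nat.exists_eq_add_of_le' hk
  fin_cases a
  · exact List.suffix_rfl
  · exact zeroWord_suffix_oneWord hm k

/-- Uniform recurrence: u_k ends the block following the one that contains `i`, and blocks have
length at most 2 d_k. -/
lemma exists_occursAt_zeroWord (hm : Admissible m) {k : ℕ} (hk : 1 ≤ k) (i : ℕ) :
    ∃ i', i ≤ i' ∧ i' ≤ i + 4 * height m k ∧ OccursAt (limitSeq m) (zeroWord m k) i' := by
  obtain ⟨s, a, t, h, h1, h2, h3⟩ := exists_blocks hm k i 1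
  obtain _ | ⟨b, t⟩ := t
  · simp at h3
  have ha := length_rho_le hm k a
  have hb := length_rho_le hm k b
  have hb' := height_le_length_rho hm k b
  simp only [List.flatMap_append, List.flatMap_cons, occursAt_append, zero_add] at h
  refine ⟨_, ?_, ?_, h.2.2.1.suffix (zeroWord_suffix_rho hm hk b)⟩ <;>
    unfold height at * <;> omega

lemma isMinimal_factorSubshift (hm : Admissible m) :
    IsMinimal (factorSubshift (limitSeq m)) := by
  intro x hx
  refine Set.Subset.antisymm (fun z hz => mem_orbitClosure_of_forall fun r => ?_)
    (orbitClosure_subset _ hx)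
  obtain ⟨i, hi⟩ := hz (-r) (2 * r + 1)
  set k := i + 2 * r + 1 with hk
  have hk' : i + 2 * r < height m k := lt_height hm _
  -- A window of `x` long enough for a gap of at most 4 d_k followed by a full u_k, which contains
  -- the wanted word of `z`.
  obtain ⟨i₁, h1⟩ := hx 0 (6 * height m k)
  obtain ⟨i₂, h2, h3, h4⟩ := exists_occursAt_zeroWord hm (k := k) (by omega) i₁
  refine ⟨(i₂ - i₁ + i + r : ℕ), fun j hj1 hj2 => ?_⟩
  obtain ⟨t, rfl⟩ : ∃ t : ℕ, j = -r + t := ⟨(j + r).toNat, by omega⟩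
  rw [hi t (by omega)]
  have h5 := h4 (i + t) (by unfold height at *; omega)
  rw [occursAt_zeroWord_zero hm (k := k) (by omega) (i + t) (by unfold height at *; omega),
    Option.some_inj, zero_add] at h5
  rw [h5]
  have h6 := h1 (i₂ - i₁ + i + t) (by omega)
  rw [zero_add] at h6
  convert h6 using 2
  · push_cast; ring
  · omega

lemma isOrbitClosureOfOneSided_factorSubshift (hm : Admissible m) :
    IsOrbitClosureOfOneSided (factorSubshift (limitSeq m)) (limitSeq m) :=
  ⟨isMinimal_factorSubshift hm, twoSidedSeq m, twoSidedSeq_mem hm,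
    ⟨0, fun i => by rw [zero_add, twoSidedSeq_natCast]⟩,
    isMinimal_factorSubshift hm _ (twoSidedSeq_mem hm)⟩

lemma languageOfLength_factorSubshift (hm : Admissible m) (q : ℕ) :
    languageOfLength (factorSubshift (limitSeq m)) q = Set.range (factor (limitSeq m) q) := by
  ext w
  constructor
  · rintro ⟨x, hx, i, h⟩
    obtain ⟨i', h'⟩ := hx i q
    exact ⟨i', funext fun j => by rw [← h j, h' j j.2]; rfl⟩
  · rintro ⟨i, rfl⟩
    exact ⟨twoSidedSeq m, twoSidedSeq_mem hm, i, fun j => by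
      rw [← Nat.cast_add, twoSidedSeq_natCast]; rfl⟩

end Minimality

/-! ### Lower bound for the complexity: right special words. -/

section RightSpecial

/-- Each right special word of length `q` yields an additional word of length `q + 1`. -/
lemma ncard_range_factor_succ {A : Type*} [Finite A] (y : ℕ → A) (q : ℕ) (S : Set (Fin q → A))
    (hS : ∀ w ∈ S, ∃ i i', factor y q i = w ∧ factor y q i' = w ∧ y (i + q) ≠ y (i' + q)) :
    (Set.range (factor y q)).ncard + S.ncard ≤ (Set.range (factor y (q + 1))).ncard := by
  classical
  have hinit : ∀ i, Fin.init (factor y (q + 1) i) = factor y q i := fun i => rfl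
  have hlast : ∀ i, factor y (q + 1) i (Fin.last q) = y (i + q) := fun i => rfl
  have h1 : ∀ w ∈ Set.range (factor y q), ∃ i, factor y q i = w := fun w hw => hw
  choose! f hf using h1
  -- `f` chooses one occurrence of every factor; `g` will choose, for special ones, an occurrence
  -- followed by a different letter.
  have h2 : ∀ w ∈ S, ∃ i, factor y q i = w ∧ y (i + q) ≠ y (f w + q) := by
    intro w hw
    obtain ⟨i, i', hi, hi', hne⟩ := hS w hw
    by_cases h : y (i + q) = y (f w + q)
    · exact ⟨i', hi', fun h' => hne (h.trans h'.symm)⟩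
    · exact ⟨i, hi, h⟩
  choose! g hg hg' using h2
  have hinj1 : Set.InjOn (fun w => factor y (q + 1) (f w)) (Set.range (factor y q)) := by
    intro w hw w' hw' h
    have := congrArg Fin.init h
    simpa only [hinit, hf w hw, hf w' hw'] using this
  have hinj2 : Set.InjOn (fun w => factor y (q + 1) (g w)) S := by
    intro w hw w' hw' h
    have := congrArg Fin.init h
    simpa only [hinit, hg w hw, hg w' hw'] using this
  rw [← hinj1.ncard_image, ← hinj2.ncard_image,
    ← Set.ncard_union_eq]
  · refine Set.ncard_le_ncard ?_ (Set.toFinite _)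
    rintro _ (⟨w, -, rfl⟩ | ⟨w, -, rfl⟩) <;> exact ⟨_, rfl⟩
  · rw [Set.disjoint_left]
    rintro _ ⟨w, hw, rfl⟩ ⟨w', hw', h⟩
    have h3 := congrArg Fin.init h
    simp only [hinit, hf w hw, hg w' hw'] at h3
    subst h3
    have h4 := congrFun h (Fin.last q)
    simp only [hlast] at h4
    exact hg' w' hw' h4

variable {m : ℕ → ℕ}

/-- The length of the longest common prefix of `zeroWord m k` and `oneWord m k`. -/
def commonLength (m : ℕ → ℕ) : ℕ → ℕ
  | 0 => 0
  | k + 1 => (m (k + 1) - 1) * height m k + commonLength m k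

lemma commonLength_lt (hm : Admissible m) (k : ℕ) : commonLength m k < height m k := by
  induction k with
  | zero => simp [commonLength, height]
  | succ k ih =>
    rw [commonLength, height_succ]
    have := height_le_length_oneWord hm k
    omega

/-- After the shared power, `oneWord` continues with u_k and `zeroWord` with v_k. The comparison
thus descends one level with the roles exchanged. -/
lemma oneWord_succ_split (hm : Admissible m) (k : ℕ) :
    oneWord m (k + 1) = wordPow (zeroWord m k) (m (k + 1) - 1) ++
      (zeroWord m k ++ (wordPow (zeroWord m k) (m (k + 1) - 1) ++ oneWord m k)) := by
  have hp := hm.pos k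
  rw [oneWord_succ, show 2 * m (k + 1) - 1 = (m (k + 1) - 1) + (m (k + 1) - 1 + 1) by omega,
    wordPow_add, wordPow_succ]
  simp only [List.append_assoc]

lemma getElem?_oneWord_of_lt (hm : Admissible m) (k : ℕ) {r : ℕ} (hr : r < commonLength m k) :
    (oneWord m k)[r]? = (zeroWord m k)[r]? := by
  induction k generalizing r with
  | zero => simp [commonLength] at hr
  | succ k ih =>
    have hlen : (wordPow (zeroWord m k) (m (k + 1) - 1)).length =
      (m (k + 1) - 1) * height m k := length_wordPow _ _
    rw [commonLength] at hr
    rw [oneWord_succ_split hm, zeroWord_succ]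
    rcases lt_or_ge r ((m (k + 1) - 1) * height m k) with h | h
    · rw [List.getElem?_append_left (by omega), List.getElem?_append_left (by omega)]
    · have hc := commonLength_lt hm k
      have hz : (zeroWord m k).length = height m k := rfl
      conv_rhs => rw [List.getElem?_append_right (by omega)]
      rw [List.getElem?_append_right (by omega), List.getElem?_append_left (by omega),
        ih (by omega)]

lemma getElem?_oneWord_ne (hm : Admissible m) (k : ℕ) :
    (oneWord m k)[commonLength m k]? ≠ (zeroWord m k)[commonLength m k]? := by
  induction k with
  | zero => simp [commonLength]
  | succ k ih =>
    have hlen : (wordPow (zeroWord m k) (m (k + 1) - 1)).length =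
      (m (k + 1) - 1) * height m k := length_wordPow _ _
    have hc := commonLength_lt hm k
    have hz : (zeroWord m k).length = height m k := rfl
    rw [commonLength, oneWord_succ_split hm, zeroWord_succ]
    conv_rhs => rw [List.getElem?_append_right (by omega), hlen, Nat.add_sub_cancel_left]
    rw [List.getElem?_append_right (by omega), hlen, Nat.add_sub_cancel_left,
      List.getElem?_append_left (by omega)]
    exact ih.symm

/-- Near the end of a power of `zeroWord m k`, the limit sequence has period `height m k`, and the
first failure of this period is known. -/
lemma period_of_occursAt (hm : Admissible m) {k i M : ℕ}
    (h : OccursAt (limitSeq m) (wordPow (zeroWord m k) (M + 1) ++ oneWord m k) i) :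
    (∀ s < M * height m k + commonLength m k,
      limitSeq m (i + s) = limitSeq m (i + s + height m k)) ∧
    limitSeq m (i + (M * height m k + commonLength m k)) ≠
      limitSeq m (i + (M * height m k + commonLength m k) + height m k) := by
  obtain ⟨h1, h2⟩ := occursAt_append.1 h
  rw [length_wordPow] at h2
  have hc := commonLength_lt hm k
  have he := height_le_length_oneWord hm k
  have hM : OccursAt (limitSeq m) (zeroWord m k) (i + M * height m k) :=
    occursAt_wordPow.1 h1 M (by omega)
  have key : ∀ r, r ≤ commonLength m k →
      (zeroWord m k)[r]? = some (limitSeq m (i + (M * height m k + r))) ∧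
      (oneWord m k)[r]? = some (limitSeq m (i + (M * height m k + r) + height m k)) := by
    intro r hr
    refine ⟨?_, ?_⟩
    · rw [hM r (by change _ < height m k; omega), add_assoc]
    · rw [h2 r (by omega)]
      congr 2
      change i + (M + 1) * height m k + r = _
      ring
  refine ⟨fun s hs => ?_, fun hs => ?_⟩
  · rcases lt_or_ge s (M * height m k) with hl | hl
    · have h3 := h1.wordPow_getElem? (t := s) (by
        change s < (M + 1) * height m k; linarith [Nat.succ_mul M (height m k)])
      have h4 := h1.wordPow_getElem? (t := s + (zeroWord m k).length) (by
        change s + height m k < (M + 1) * height m k; linarith [Nat.succ_mul M (height m k)])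
      rw [Nat.add_mod_right, h3, Option.some_inj, ← add_assoc] at h4
      exact h4
    · obtain ⟨r, rfl⟩ := Nat.exists_eq_add_of_le hl
      obtain ⟨h3, h4⟩ := key r (by omega)
      rw [getElem?_oneWord_of_lt hm k (by omega), h3, Option.some_inj] at h4
      exact h4
  · obtain ⟨h3, h4⟩ := key _ le_rfl
    exact getElem?_oneWord_ne hm k (by rw [h3, h4, hs])

/-- The word `zeroWord m k ^ (2 * m (k + 1)) ++ oneWord m k` occurs in the limit sequence. -/
lemma exists_occursAt_wordPow (hm : Admissible m) {k : ℕ} (hk : 1 ≤ k) :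
    ∃ i, OccursAt (limitSeq m)
      (wordPow (zeroWord m k) (2 * m (k + 1) - 1 + 1) ++ oneWord m k) i := by
  have h := occursAt_zeroWord_zero hm (k := k + 2) (by omega)
  have h8 := hm.eight_le (k := k + 2) (by omega)
  obtain ⟨a, ha⟩ := Nat.exists_eq_add_of_le' h8
  -- The extra copy of u_k is the end of the u_{k+1} that precedes v_{k+1} inside u_{k+2}.
  obtain ⟨r, hr⟩ := zeroWord_suffix hm hk (Nat.le_succ k)
  rw [zeroWord_succ (k + 1), ha, show a + 8 - 1 = a + 6 + 1 by omega, wordPow_succ',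
    oneWord_succ, ← hr] at h
  simp only [List.append_assoc, occursAt_append (w' := zeroWord m k ++ _),
    occursAt_append (w := wordPow _ _)] at h
  exact ⟨_, by rw [wordPow_succ, List.append_assoc]; exact h.2.2⟩

/-- The words of length `q` that end at the first failure of the period, respectively one period
later, agree. -/
lemma factor_eq_of_occursAt (hm : Admissible m) {k i M q : ℕ}
    (h : OccursAt (limitSeq m) (wordPow (zeroWord m k) (M + 1) ++ oneWord m k) i)
    (hq : q ≤ M * height m k + commonLength m k) :
    factor (limitSeq m) q (i + (M * height m k + commonLength m k) - q + height m k) =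
      factor (limitSeq m) q (i + (M * height m k + commonLength m k) - q) := by
  funext j
  have h1 := (period_of_occursAt hm h).1 (M * height m k + commonLength m k - q + j) (by omega)
  unfold factor
  convert h1.symm using 2 <;> omega

lemma limitSeq_ne_of_occursAt (hm : Admissible m) {k i M q : ℕ}
    (h : OccursAt (limitSeq m) (wordPow (zeroWord m k) (M + 1) ++ oneWord m k) i)
    (hq : q ≤ M * height m k + commonLength m k) :
    limitSeq m (i + (M * height m k + commonLength m k) - q + q) ≠
      limitSeq m (i + (M * height m k + commonLength m k) - q + height m k + q) := by
  have h1 := (period_of_occursAt hm h).2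
  rwa [show i + (M * height m k + commonLength m k) - q + q =
    i + (M * height m k + commonLength m k) by omega,
    show i + (M * height m k + commonLength m k) - q + height m k + q =
    i + (M * height m k + commonLength m k) + height m k by omega]

/-- The length of the longest right special word that has period `height m k`. -/
def specialLength (m : ℕ → ℕ) (k : ℕ) : ℕ :=
  (2 * m (k + 1) - 1) * height m k + commonLength m k

lemma height_le_specialLength (hm : Admissible m) (k : ℕ) : height m k ≤ specialLength m k := by
  have := hm.pos k
  have h1 : 1 * height m k ≤ (2 * m (k + 1) - 1) * height m k :=
    Nat.mul_le_mul_right _ (by omega)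
  unfold specialLength
  omega

lemma specialLength_le (hm : Admissible m) (k : ℕ) :
    specialLength m k + 1 ≤ 2 * m (k + 1) * height m k := by
  have := hm.pos k
  have h1 := commonLength_lt hm k
  obtain ⟨a, ha⟩ := Nat.exists_eq_add_of_le' this
  rw [specialLength, ha, show 2 * (a + 1) - 1 = 2 * a + 1 by omega,
    show 2 * (a + 1) = 2 * a + 1 + 1 by omega, Nat.succ_mul (2 * a + 1)]
  omega

lemma complexity_factorSubshift (hm : Admissible m) (q : ℕ) :
    complexity (factorSubshift (limitSeq m)) q = (Set.range (factor (limitSeq m) q)).ncard := by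
  rw [complexity, languageOfLength_factorSubshift hm]

/-- Level `q + 1` supplies a right special word of length `q`, because q ≤ d_{q+1} ≤ `specialLength
m (q + 1)`. -/
lemma complexity_succ (hm : Admissible m) (q : ℕ) :
    complexity (factorSubshift (limitSeq m)) q + 1 ≤
      complexity (factorSubshift (limitSeq m)) (q + 1) := by
  obtain ⟨i, hi⟩ := exists_occursAt_wordPow hm (k := q + 1) (by omega)
  have hq : q ≤ specialLength m (q + 1) :=
    (lt_height hm q).le.trans (height_le_specialLength hm _)
  rw [complexity_factorSubshift hm, complexity_factorSubshift hm]
  have := ncard_range_factor_succ (limitSeq m) q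
    {factor (limitSeq m) q (i + specialLength m (q + 1) - q)} ?_
  · rwa [Set.ncard_singleton] at this
  rintro _ rfl
  exact ⟨_, _, rfl, factor_eq_of_occursAt hm hi hq, limitSeq_ne_of_occursAt hm hi hq⟩

lemma le_complexity (hm : Admissible m) (q : ℕ) :
    q ≤ complexity (factorSubshift (limitSeq m)) q := by
  induction q with
  | zero => exact Nat.zero_le _
  | succ q ih => have := complexity_succ hm q; omega

/-- The period `height m k` fails at a known place before the end of the long right special words
of the next level. -/
lemma limitSeq_ne_of_occursAt_succ (hm : Admissible m) {k i M : ℕ} (hk : 1 ≤ k)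
    (h : OccursAt (limitSeq m) (wordPow (zeroWord m (k + 1)) (M + 1)) i) :
    limitSeq m (i + (M + 1) * height m (k + 1) - (oneWord m k).length + commonLength m k) ≠
      limitSeq m
        (i + (M + 1) * height m (k + 1) - (oneWord m k).length + commonLength m k - height m k) := by
  have h1 := occursAt_wordPow.1 h M (by omega)
  have h8 := hm.eight_le (k := k + 1) (by omega)
  obtain ⟨a, ha⟩ := Nat.exists_eq_add_of_le' h8
  have hlen : (zeroWord m (k + 1)).length = height m (k + 1) := rfl
  have hlen' : (zeroWord m k).length = height m k := rfl
  have hs := height_succ (m := m) k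
  have hc := commonLength_lt hm k
  have he := height_le_length_oneWord hm k
  rw [ha, show a + 8 - 1 = a + 6 + 1 by omega] at hs
  rw [hlen, zeroWord_succ, ha, show a + 8 - 1 = a + 6 + 1 by omega, wordPow_succ', occursAt_append,
    occursAt_append, List.length_append, length_wordPow, hlen'] at h1
  have h2 := h1.2 (commonLength m k) (by omega)
  have h3 := h1.1.2 (commonLength m k) (by omega)
  have h4 := getElem?_oneWord_ne hm k
  rw [h2, h3, Ne, Option.some_inj] at h4
  rw [Nat.succ_mul] at hs
  convert h4 using 3
  · rw [Nat.succ_mul]; omega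
  · rw [Nat.succ_mul]; omega

/-- Levels k and k+1 each give a right special word. The first has period d_k. In the second this
period fails inside its last complete u_{k+1}, where v_k follows u_k. That failure lies at most
(m_{k+1} + 1) d_k before the end, and seeing it takes one more period, hence the lower bound on `q`.
-/
lemma complexity_add_two (hm : Admissible m) {k q : ℕ} (hk : 1 ≤ k)
    (h1 : (m (k + 1) + 2) * height m k ≤ q) (h2 : q ≤ specialLength m k) :
    complexity (factorSubshift (limitSeq m)) q + 2 ≤
      complexity (factorSubshift (limitSeq m)) (q + 1) := by
  obtain ⟨i, hi⟩ := exists_occursAt_wordPow hm hk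
  obtain ⟨i', hi'⟩ := exists_occursAt_wordPow hm (k := k + 1) (by omega)
  have h8 := hm.eight_le (k := k + 1) (by omega)
  have h8' := hm.eight_le (k := k + 1 + 1) (by omega)
  have hsp : specialLength m k ≤ specialLength m (k + 1) := by
    have := specialLength_le hm k
    have h3 := mul_height_le hm k
    have h4 : 2 * height m (k + 1) ≤ (2 * m (k + 1 + 1) - 1) * height m (k + 1) :=
      Nat.mul_le_mul_right _ (by omega)
    rw [mul_assoc] at this
    have h5 : height m (k + 1) ≤ height m (k + 1 + 1) := height_mono hm (by omega)
    have h6 : (2 * m (k + 1 + 1) - 1) * height m (k + 1) ≤ specialLength m (k + 1) :=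
      Nat.le_add_right _ _
    omega
  rw [complexity_factorSubshift hm, complexity_factorSubshift hm]
  have hne : factor (limitSeq m) q (i + specialLength m k - q) ≠
      factor (limitSeq m) q (i' + specialLength m (k + 1) - q) := by
    intro heq
    have h3 := (occursAt_append.1 hi').1
    obtain ⟨M, hM⟩ : ∃ M, 2 * m (k + 1 + 1) - 1 = M + 1 := ⟨2 * m (k + 1 + 1) - 2, by omega⟩
    rw [wordPow_succ', occursAt_append, hM] at h3
    have h4 := limitSeq_ne_of_occursAt_succ hm hk h3.1
    have hsp' : specialLength m (k + 1) =
        (M + 1) * height m (k + 1) + ((m (k + 1) - 1) * height m k + commonLength m k) := by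
      rw [specialLength, hM, commonLength]
    have hd := height_pos hm k
    have he := length_oneWord_le hm k
    have he' := height_le_length_oneWord hm k
    have hc := commonLength_lt hm k
    have ht : (m (k + 1) - 1) * height m k + 3 * height m k = (m (k + 1) + 2) * height m k := by
      rw [← Nat.add_mul]; congr 1; omega
    have hX : height m (k + 1) ≤ (M + 1) * height m (k + 1) := Nat.le_mul_of_pos_left _ (by omega)
    have hs := height_succ (m := m) k
    set t := (oneWord m k).length + (m (k + 1) - 1) * height m k with ht'
    set N := specialLength m (k + 1)
    have h5 := congrFun heq ⟨q - t, by omega⟩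
    have h6 := congrFun heq ⟨q - t - height m k, by omega⟩
    simp only [factor] at h5 h6
    have h7 := (period_of_occursAt hm hi).1 (specialLength m k - t - height m k) (by
      change _ < specialLength m k
      omega)
    apply h4
    rw [show i' + (M + 1) * height m (k + 1) - (oneWord m k).length + commonLength m k =
      i' + N - q + (q - t) by omega,
      show i' + N - q + (q - t) - height m k = i' + N - q + (q - t - height m k) by omega,
      ← h5, ← h6]
    convert h7.symm using 2 <;> omega
  have hcard := ncard_range_factor_succ (limitSeq m) q
    {factor (limitSeq m) q (i + specialLength m k - q),
      factor (limitSeq m) q (i' + specialLength m (k + 1) - q)} ?_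
  · rwa [Set.ncard_pair hne] at hcard
  rintro _ (rfl | rfl)
  · exact ⟨_, _, rfl, factor_eq_of_occursAt hm hi h2, limitSeq_ne_of_occursAt hm hi h2⟩
  · exact ⟨_, _, rfl, factor_eq_of_occursAt hm hi' (h2.trans hsp),
      limitSeq_ne_of_occursAt hm hi' (h2.trans hsp)⟩

/-- From p(a) ≥ a the complexity climbs with slope at least 2. The loss 4 d_k arises from 2 (2m - 1)
- (m + 2) = 3m - 4, where m = m_{k+1}. -/
lemma le_complexity_specialLength (hm : Admissible m) {k : ℕ} (hk : 1 ≤ k) :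
    3 * m (k + 1) * height m k ≤
      complexity (factorSubshift (limitSeq m)) (specialLength m k + 1) + 4 * height m k := by
  have h8 := hm.eight_le (k := k + 1) (by omega)
  set a := (m (k + 1) + 2) * height m k with ha
  have key : ∀ j, a + j ≤ specialLength m k + 1 →
      a + 2 * j ≤ complexity (factorSubshift (limitSeq m)) (a + j) := by
    intro j
    induction j with
    | zero => intro _; exact le_complexity hm a
    | succ j ih =>
      intro hj
      have h1 := ih (by omega)
      have h2 := complexity_add_two hm hk (q := a + j) (by omega) (by omega)
      rw [← add_assoc]
      omega
  obtain ⟨b, hb⟩ := Nat.exists_eq_add_of_le' h8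
  have hs : specialLength m k = (2 * b + 15) * height m k + commonLength m k := by
    rw [specialLength, hb]; congr 2
  have ha' : a = (b + 10) * height m k := by rw [ha, hb]
  have hle : a + ((b + 5) * height m k + commonLength m k + 1) = specialLength m k + 1 := by
    rw [hs, ha']; ring
  have h3 := key _ hle.le
  rw [hle, ha'] at h3
  rw [hb]
  nlinarith [h3]

end RightSpecial

/-! ### Upper bound for the complexity: windows with at most two pulses. -/

section UpperBound

/-- The two-sided periodic sequence with period word `w`. -/
def periodicSeq (w : List (Fin 2)) (t : ℤ) : Fin 2 := w.getD (t % w.length).toNat 0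

lemma periodicSeq_add_mul (w : List (Fin 2)) (t n : ℤ) :
    periodicSeq w (t + n * w.length) = periodicSeq w t := by
  simp [periodicSeq]

lemma periodicSeq_natCast (w : List (Fin 2)) (t : ℕ) :
    periodicSeq w t = w.getD (t % w.length) 0 := by
  rw [periodicSeq, ← Int.natCast_mod, Int.toNat_natCast]

lemma OccursAt.eq_periodicSeq {y : ℕ → Fin 2} {w : List (Fin 2)} {i j t : ℕ}
    (h : OccursAt y (wordPow w j) i) (ht : t < j * w.length) : y (i + t) = periodicSeq w t := by
  rw [periodicSeq_natCast, List.getD_eq_getElem?_getD, h.wordPow_getElem? ht, Option.getD_some]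

lemma OccursAt.eq_getD {y : ℕ → Fin 2} {w : List (Fin 2)} {i t : ℕ}
    (h : OccursAt y w i) (ht : t < w.length) : y (i + t) = w.getD t 0 := by
  rw [List.getD_eq_getElem?_getD, h t ht, Option.getD_some]

/-- The two-sided sequence `⋯ u u p u u ⋯` in which `p` starts at position `0`. -/
def onePulse (u p : List (Fin 2)) (t : ℤ) : Fin 2 :=
  if t < 0 then periodicSeq u t else if t < p.length then p.getD t.toNat 0
  else periodicSeq u (t - p.length)

/-- The two-sided sequence `⋯ u u p u ^ M p u u ⋯` in which the first `p` starts at position `0`. -/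
def twoPulse (u p : List (Fin 2)) (M : ℕ) (t : ℤ) : Fin 2 :=
  if t < p.length + M * u.length then onePulse u p t
  else onePulse u p (t - (p.length + M * u.length))

/-- A gap u^(2M) keeps the next pulse out of the window. After a gap u^M the window may see a second
pulse, but it ends within the u^M that follows. -/
lemma eq_pulse_of_occursAt {y : ℕ → Fin 2} {u p : List (Fin 2)} {B L M z i q : ℕ}
    (hz : z = 1 ∨ z = 2)
    (h : OccursAt y (wordPow u L ++ (p ++ (wordPow u (M * z) ++ (p ++ wordPow u M)))) B)
    (h1 : B ≤ i) (h2 : i < B + L * u.length + p.length) (hq : q ≤ (2 * M - 1) * u.length) :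
    ∃ a : ℤ, a < p.length ∧ ((∀ j < q, y (i + j) = onePulse u p (a + j)) ∨
      ∀ j < q, y (i + j) = twoPulse u p M (a + j)) := by
  simp only [occursAt_append, length_wordPow] at h
  obtain ⟨hA, hB, hC, hD, hE⟩ := h
  have hq' : q ≤ 2 * (M * u.length) := by
    refine hq.trans ?_
    rw [← mul_assoc]
    exact Nat.mul_le_mul_right _ (by omega)
  -- `key` reads `y` around the first pulse, `key'` around the second one.
  have key : ∀ t : ℤ, -(L * u.length : ℕ) ≤ t → t < p.length + (M * z * u.length : ℕ) →
      y (B + L * u.length + t).toNat = onePulse u p t := by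
    intro t ht1 ht2
    unfold onePulse
    split_ifs with h3 h4
    · obtain ⟨s, hs⟩ : ∃ s : ℕ, t = s - (L * u.length : ℕ) :=
        ⟨(t + (L * u.length : ℕ)).toNat, by omega⟩
      have h5 := hA.eq_periodicSeq (t := s) (by omega)
      have h6 : t = s + (-(L : ℤ)) * u.length := by rw [hs]; push_cast; ring
      rw [h6, periodicSeq_add_mul, ← h5]
      congr 1
      rw [← h6]
      push_cast at hs
      omega
    · lift t to ℕ using by omega
      rw [Int.toNat_natCast, ← hB.eq_getD (t := t) (by omega)]
      congr 1
    · obtain ⟨s, hs⟩ : ∃ s : ℕ, t = s + p.length := ⟨(t - p.length).toNat, by omega⟩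
      rw [hs, add_sub_cancel_right, ← hC.eq_periodicSeq (t := s) (by omega)]
      congr 1
      omega
  have key' : ∀ t : ℤ, 0 ≤ t → t < p.length + (M * u.length : ℕ) →
      y (B + L * u.length + p.length + (M * z * u.length : ℕ) + t).toNat = onePulse u p t := by
    intro t ht1 ht2
    unfold onePulse
    split_ifs with h3 h4
    · omega
    · obtain ⟨t, rfl⟩ := Int.eq_ofNat_of_zero_le ht1
      rw [Int.toNat_natCast, ← hD.eq_getD (t := t) (by omega)]
      congr 1
    · obtain ⟨s, hs⟩ : ∃ s : ℕ, t = s + p.length := ⟨(t - p.length).toNat, by omega⟩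
      rw [hs, add_sub_cancel_right, ← hE.eq_periodicSeq (t := s) (by omega)]
      congr 1
      omega
  refine ⟨i - (B + L * u.length), by omega, ?_⟩
  have hi : ∀ j : ℕ, i + j = (B + L * u.length + ((i - (B + L * u.length) : ℤ) + j)).toNat := by
    intro j; omega
  have hL : ((L * u.length : ℕ) : ℤ) = L * u.length := by push_cast; ring
  rcases hz with rfl | rfl
  · right
    intro j hj
    rw [mul_one] at key key'
    unfold twoPulse
    have hM : ((M * u.length : ℕ) : ℤ) = M * u.length := by push_cast; ring
    split_ifs with h3
    · rw [hi, key _ (by omega) (by omega)]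
    · rw [← key' _ (by omega) (by omega)]
      congr 1
      omega
  · left
    intro j hj
    rw [hi, key _ (by omega) (by
      rw [show M * 2 * u.length = 2 * (M * u.length) by ring]; omega)]

/-- The pulse stays invisible on its first `c` letters, where it agrees with `u`. -/
lemma onePulse_of_lt {u p : List (Fin 2)} {c : ℕ} (hcu : c ≤ u.length) (hcp : c ≤ p.length)
    (hc : ∀ t < c, p.getD t 0 = u.getD t 0) {t : ℤ} (ht : t < c) :
    onePulse u p t = periodicSeq u t := by
  unfold onePulse
  split_ifs with h1 h2
  · rfl
  · lift t to ℕ using by omega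
    rw [periodicSeq_natCast, Int.toNat_natCast, hc t (by omega), Nat.mod_eq_of_lt (by omega)]
  · omega

lemma twoPulse_of_lt {u p : List (Fin 2)} {c M : ℕ} (hcu : c ≤ u.length) (hcp : c ≤ p.length)
    (hc : ∀ t < c, p.getD t 0 = u.getD t 0) {t : ℤ} (ht : t < p.length + M * u.length + c) :
    twoPulse u p M t = onePulse u p t := by
  unfold twoPulse
  split_ifs with h1
  · rfl
  · have hM : (0 : ℤ) ≤ M * u.length := by positivity
    rw [onePulse_of_lt hcu hcp hc (by omega), onePulse, if_neg (by omega), if_neg (by omega)]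
    rw [← periodicSeq_add_mul u _ M]
    congr 1
    ring

/-- The number of words of length `q` in a sequence whose factors are those of the model
sequences `onePulse` and `twoPulse`. -/
lemma ncard_range_factor_le {y : ℕ → Fin 2} {u p : List (Fin 2)} {c M q : ℕ} (hu : 0 < u.length)
    (hcu : c ≤ u.length) (hcp : c ≤ p.length) (hc : ∀ t < c, p.getD t 0 = u.getD t 0)
    (h : ∀ i, ∃ a : ℤ, a < p.length ∧ ((∀ j < q, y (i + j) = onePulse u p (a + j)) ∨
      ∀ j < q, y (i + j) = twoPulse u p M (a + j))) :
    (Set.range (factor y q)).ncard ≤ u.length + (q + (p.length - c)) + (q - M * u.length) := by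
  classical
  -- The purely periodic windows, those of `onePulse` that reach beyond the invisible part of the
  -- pulse, and those of `twoPulse` that do so for the second pulse.
  set S₁ := (Finset.Ico (0 : ℤ) u.length).image fun a (j : Fin q) => periodicSeq u (a + (j : ℕ))
  set S₂ := (Finset.Ioo (c - q : ℤ) p.length).image fun a (j : Fin q) => onePulse u p (a + (j : ℕ))
  set S₃ := (Finset.Ioo (p.length + M * u.length + c - q : ℤ) p.length).image
    fun a (j : Fin q) => twoPulse u p M (a + (j : ℕ))
  have hone : ∀ a : ℤ, a < p.length → (fun j : Fin q => onePulse u p (a + (j : ℕ))) ∈ S₁ ∪ S₂ := by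
    intro a ha
    rcases lt_or_ge (c - q : ℤ) a with h1 | h1
    · exact Finset.mem_union_right _ (Finset.mem_image.2 ⟨a, Finset.mem_Ioo.2 ⟨h1, ha⟩, rfl⟩)
    · refine Finset.mem_union_left _ (Finset.mem_image.2 ⟨a % u.length, ?_, ?_⟩)
      · exact Finset.mem_Ico.2 ⟨Int.emod_nonneg _ (by omega), Int.emod_lt_of_pos _ (by omega)⟩
      · funext j
        rw [onePulse_of_lt hcu hcp hc (by have := j.2; omega),
          ← periodicSeq_add_mul u _ (a / u.length)]
        congr 1
        have := Int.emod_add_mul_ediv a u.length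
        linarith
  have hsub : Set.range (factor y q) ⊆ ((S₁ ∪ S₂ ∪ S₃ : Finset (Fin q → Fin 2)) : Set _) := by
    rintro _ ⟨i, rfl⟩
    obtain ⟨a, ha, h1 | h1⟩ := h i
    · have : factor y q i = fun j : Fin q => onePulse u p (a + (j : ℕ)) :=
        funext fun j => h1 j j.2
      rw [this]
      exact Finset.mem_coe.2 (Finset.mem_union_left _ (hone a ha))
    · have : factor y q i = fun j : Fin q => twoPulse u p M (a + (j : ℕ)) :=
        funext fun j => h1 j j.2
      rw [this]
      rcases lt_or_ge (p.length + M * u.length + c - q : ℤ) a with h2 | h2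
      · exact Finset.mem_coe.2 (Finset.mem_union_right _
          (Finset.mem_image.2 ⟨a, Finset.mem_Ioo.2 ⟨h2, ha⟩, rfl⟩))
      · refine Finset.mem_coe.2 (Finset.mem_union_left _ ?_)
        convert hone a ha using 2 with j
        exact twoPulse_of_lt hcu hcp hc (by have := j.2; omega)
  refine (Set.ncard_le_ncard hsub (Finset.finite_toSet _)).trans ?_
  rw [Set.ncard_coe_finset]
  have h1 : S₁.card ≤ u.length := Finset.card_image_le.trans (by simp)
  have h2 : S₂.card ≤ q + (p.length - c) := Finset.card_image_le.trans (by
    rw [Int.card_Ioo]; omega)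
  have h3 : S₃.card ≤ q - M * u.length := Finset.card_image_le.trans (by
    rw [Int.card_Ioo]
    have hM : ((M * u.length : ℕ) : ℤ) = M * u.length := by push_cast; ring
    omega)
  have h4 := Finset.card_union_le (S₁ ∪ S₂) S₃
  have h5 := Finset.card_union_le S₁ S₂
  omega

variable {m : ℕ → ℕ}

/-- With v_{k+1} = p u_{k+1}, both blocks of level k+2 contain exactly one displayed pulse p. The
final u_{k+1} belongs to the run of the next block, whence the exponent `m (k + 2) * z - 1`. -/
lemma rho_succ_eq (hm : Admissible m) (k : ℕ) (a : Fin 2) :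
    ∃ z, (z = 1 ∨ z = 2) ∧ rho m (fun k => 2 * m k) (k + 2) a =
      wordPow (zeroWord m (k + 1)) (m (k + 2) * z - 1) ++
        (wordPow (zeroWord m k) (m (k + 1)) ++ zeroWord m (k + 1)) := by
  rw [← oneWord_succ_eq hm]
  fin_cases a
  · exact ⟨1, Or.inl rfl, by rw [mul_one]; exact zeroWord_succ (k + 1)⟩
  · exact ⟨2, Or.inr rfl, by rw [mul_comm]; exact oneWord_succ (k + 1)⟩

lemma exists_eq_pulse (hm : Admissible m) (k : ℕ) {q : ℕ}
    (hq : q ≤ (2 * m (k + 2) - 1) * height m (k + 1)) (i : ℕ) :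
    ∃ a : ℤ, a < (wordPow (zeroWord m k) (m (k + 1))).length ∧
      ((∀ j < q, limitSeq m (i + j) =
        onePulse (zeroWord m (k + 1)) (wordPow (zeroWord m k) (m (k + 1))) (a + j)) ∨
      ∀ j < q, limitSeq m (i + j) =
        twoPulse (zeroWord m (k + 1)) (wordPow (zeroWord m k) (m (k + 1))) (m (k + 2)) (a + j)) := by
  obtain ⟨s, a, t, h, h1, h2, h3⟩ := exists_blocks hm (k + 2) i 3
  obtain _ | ⟨b, _ | ⟨c, _ | ⟨e, t⟩⟩⟩ := t
  · simp at h3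
  · simp at h3
  · simp at h3
  have hM := hm.pos (k + 1)
  obtain ⟨za, hza, ha⟩ := rho_succ_eq hm k a
  obtain ⟨zb, hzb, hb⟩ := rho_succ_eq hm k b
  obtain ⟨zc, hzc, hc⟩ := rho_succ_eq hm k c
  obtain ⟨ze, hze, he⟩ := rho_succ_eq hm k e
  set u := zeroWord m (k + 1) with hu
  set p := wordPow (zeroWord m k) (m (k + 1)) with hp
  set M := m (k + 2)
  set ρ := rho m (fun k => 2 * m k) (k + 2)
  have hz : ∀ z, z = 1 ∨ z = 2 → M ≤ M * z := by
    rintro z (rfl | rfl) <;> omega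
  have hpow : ∀ z, z = 1 ∨ z = 2 → ∀ l, u ++ (wordPow u (M * z - 1) ++ l) = wordPow u (M * z) ++ l := by
    intro z h l
    have := hz z h
    rw [← List.append_assoc, ← wordPow_succ, Nat.sub_add_cancel (by omega)]
  have hsplit : ∀ z, z = 1 ∨ z = 2 → ∀ l, ∃ l', wordPow u (M * z) ++ l = wordPow u M ++ l' := by
    intro z h l
    have := hz z h
    exact ⟨wordPow u (M * z - M) ++ l, by
      rw [← List.append_assoc, ← wordPow_add, Nat.add_sub_cancel' this]⟩
  simp only [List.flatMap_append (xs := s), List.flatMap_cons, ha, hb, hc, he,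
    List.append_assoc, hpow _ hzb, hpow _ hzc, hpow _ hze] at h
  have h4 := (occursAt_append.1 h).2
  rw [zero_add] at h4
  set P := (s.flatMap ρ).length
  have hlen : (ρ a).length = (M * za - 1) * u.length + p.length + u.length := by
    rw [ha]; simp [add_assoc]
  -- Beyond the pulse of its block, `i` lies in the final `u`, and the window is compared with the
  -- pulse of the next block.
  rcases lt_or_ge i (P + (M * za - 1) * u.length + p.length) with h5 | h5
  · obtain ⟨l, hl⟩ := hsplit zc hzc (p ++ (wordPow u (M * ze) ++ (p ++ (u ++ t.flatMap ρ))))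
    rw [hl] at h4
    refine eq_pulse_of_occursAt hzb (h4.prefix ?_) h1 h5 hq
    exact ⟨l, by simp⟩
  · have h6 := (occursAt_append.1 (occursAt_append.1 h4).2).2
    obtain ⟨l, hl⟩ := hsplit ze hze (p ++ (u ++ t.flatMap ρ))
    rw [hl, length_wordPow] at h6
    refine eq_pulse_of_occursAt (L := M * zb) hzc (h6.prefix ?_) h5 ?_ hq
    · exact ⟨l, by simp⟩
    · have h7 := Nat.mul_le_mul_right u.length (hM.trans (hz zb hzb))
      rw [one_mul] at h7
      omega

/-- The pulse u_k^m shares at least u_k^(m-1) with u_{k+1}, so only d_k of its letters enter the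
count. -/
lemma complexity_le (hm : Admissible m) (k : ℕ) {q : ℕ}
    (hq : q ≤ (2 * m (k + 2) - 1) * height m (k + 1)) :
    complexity (factorSubshift (limitSeq m)) q ≤
      q + height m (k + 1) + height m k + (q - m (k + 2) * height m (k + 1)) := by
  rw [complexity_factorSubshift hm]
  have hp := hm.pos k
  have hlen : (wordPow (zeroWord m k) (m (k + 1))).length = m (k + 1) * height m k :=
    length_wordPow _ _
  have hle : (m (k + 1) - 1) * height m k ≤ m (k + 1) * height m k :=
    Nat.mul_le_mul_right _ (by omega)
  have h := ncard_range_factor_le (y := limitSeq m) (u := zeroWord m (k + 1))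
    (p := wordPow (zeroWord m k) (m (k + 1))) (c := (m (k + 1) - 1) * height m k) (M := m (k + 2))
    (q := q) (height_pos hm (k + 1)) (hle.trans (mul_height_le hm k)) (hlen ▸ hle) ?_
    (exists_eq_pulse hm k hq)
  · have h1 : m (k + 1) * height m k - (m (k + 1) - 1) * height m k = height m k := by
      rw [← Nat.sub_mul, Nat.sub_sub_self hp, one_mul]
    rw [hlen, h1] at h
    change _ ≤ height m (k + 1) + (q + height m k) + (q - m (k + 2) * height m (k + 1)) at h
    omega
  · intro t ht
    obtain ⟨b, hb⟩ := Nat.exists_eq_add_of_le' hp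
    have hlen' : (wordPow (zeroWord m k) b).length = b * height m k := length_wordPow _ _
    rw [hb, Nat.add_sub_cancel] at ht
    rw [zeroWord_succ, hb, Nat.add_sub_cancel, wordPow_succ', List.getD_append _ _ _ _ (by omega),
      List.getD_append _ _ _ _ (by omega)]

end UpperBound

/-! ### The limit superior and infiniteness. -/

section Limsup

variable {m : ℕ → ℕ}

lemma Admissible.two_pow_le (hm : Admissible m) {k : ℕ} (hk : 2 ≤ k) : (2 : ℝ) ^ k ≤ m k := by
  have h := hm.large k hk
  have h2 : 2 ^ k ≤ m k := (Nat.pow_le_pow_right (by norm_num) (Nat.le_succ k)).trans h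
  exact_mod_cast h2

/-- Every large q lies in one interval (T k, T (k + 1)], on which the pulse count of level k
applies; all error terms are multiples of q / 2^K. -/
lemma eventually_complexity_le (hm : Admissible m) (K : ℕ) :
    ∀ᶠ q : ℕ in atTop, (complexity (factorSubshift (limitSeq m)) q : ℝ) ≤
      (3 / 2 + 5 / 2 ^ K) * q := by
  set T : ℕ → ℕ := fun k => (2 * m (k + 1) - 1) * height m k with hT
  have hTle : ∀ k, m (k + 1) * height m k ≤ T k := fun k =>
    Nat.mul_le_mul_right _ (by have := hm.pos k; omega)
  have hTh : ∀ k, height m k ≤ T k := fun k =>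
    (Nat.le_mul_of_pos_left _ (hm.pos k)).trans (hTle k)
  have hTmono : Monotone T := monotone_nat_of_le_succ fun k => by
    have h1 := mul_height_le hm k
    have h2 := hm.eight_le (k := k + 1 + 1) (by omega)
    have h3 : 2 * height m (k + 1) ≤ T (k + 1) := Nat.mul_le_mul_right _ (by omega)
    have h4 : T k ≤ 2 * m (k + 1) * height m k := Nat.mul_le_mul_right _ (by omega)
    rw [mul_assoc] at h4
    omega
  filter_upwards [eventually_gt_atTop (T (K + 1))] with q hq
  have hex : ∃ k, q ≤ T (k + 1) :=
    ⟨q, ((lt_height hm q).le.trans (hTh (q + 1)))⟩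
  obtain ⟨k, hk, hmin⟩ : ∃ k, q ≤ T (k + 1) ∧ T k < q := by
    classical
    refine ⟨Nat.find hex, Nat.find_spec hex, ?_⟩
    rcases h : Nat.find hex with _ | l
    · exact lt_of_le_of_lt (hTmono (Nat.zero_le _)) hq
    · exact not_le.1 (Nat.find_min hex (m := l) (by omega))
  have hKk : K + 1 ≤ k := by
    by_contra hlt
    exact absurd (hk.trans (hTmono (show k + 1 ≤ K + 1 by omega))) (not_le.2 hq)
  have hc := complexity_le hm k hk
  have hpow : (2 : ℝ) ^ K ≤ 2 ^ (k + 1) := pow_le_pow_right₀ (by norm_num) (by omega)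
  have hpow' : (2 : ℝ) ^ K ≤ 2 ^ (k + 2) := pow_le_pow_right₀ (by norm_num) (by omega)
  have hm1 : (2 : ℝ) ^ K ≤ m (k + 1) := hpow.trans (hm.two_pow_le (by omega))
  have hm2 : (2 : ℝ) ^ K ≤ m (k + 2) := hpow'.trans (hm.two_pow_le (by omega))
  have hK : (0 : ℝ) < 2 ^ K := by positivity
  have h1 : m (k + 1) * height m k ≤ q := (hTle k).trans hmin.le
  have h1' : (m (k + 1) : ℝ) * height m k ≤ q := by exact_mod_cast h1
  have hd : (height m k : ℝ) ≤ q / 2 ^ K := by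
    rw [le_div_iff₀ hK, mul_comm]
    exact (mul_le_mul_of_nonneg_right hm1 (Nat.cast_nonneg _)).trans h1'
  have hgoal : (3 / 2 + 5 / 2 ^ K) * (q : ℝ) = 3 / 2 * q + 5 * (q / 2 ^ K) := by ring
  have hq0 : (0 : ℝ) ≤ q / 2 ^ K := by positivity
  rw [hgoal]
  -- Before second pulses count, the excess over q is about d_{k+1}, roughly T k / 2 and so at most
  -- about q / 2. Afterwards the excess is about q - m_{k+2} d_{k+1}, at most q / 2 since q ≤ 2
  -- m_{k+2} d_{k+1}.
  rcases le_total q (m (k + 2) * height m (k + 1)) with h2 | h2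
  · rw [Nat.sub_eq_zero_of_le h2, add_zero] at hc
    have h3 := height_succ_le hm k
    have h4 : 2 * (m (k + 1) * height m k) ≤ q + height m k := by
      have h5 : T k + height m k = 2 * (m (k + 1) * height m k) := by
        have hp := hm.pos k
        rw [hT]
        simp only
        rw [← Nat.succ_mul, ← mul_assoc]
        congr 1
        omega
      omega
    have h6 : 2 * complexity (factorSubshift (limitSeq m)) q ≤ 3 * q + 5 * height m k := by omega
    have h7 : (2 : ℝ) * complexity (factorSubshift (limitSeq m)) q ≤ 3 * q + 5 * height m k := by
      exact_mod_cast h6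
    linarith
  · have h3 : T (k + 1) ≤ 2 * (m (k + 2) * height m (k + 1)) := by
      rw [← mul_assoc]
      exact Nat.mul_le_mul_right _ (Nat.sub_le _ _)
    have h4 := height_mono hm (Nat.le_succ k)
    have h6 : 2 * complexity (factorSubshift (limitSeq m)) q ≤ 3 * q + 4 * height m (k + 1) := by
      simp only [Nat.succ_eq_add_one] at h4
      omega
    have h7 : (2 : ℝ) * complexity (factorSubshift (limitSeq m)) q ≤
        3 * q + 4 * height m (k + 1) := by exact_mod_cast h6
    have h2' : (m (k + 2) : ℝ) * height m (k + 1) ≤ q := by exact_mod_cast h2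
    have hd' : (height m (k + 1) : ℝ) ≤ q / 2 ^ K := by
      rw [le_div_iff₀ hK, mul_comm]
      exact (mul_le_mul_of_nonneg_right hm2 (Nat.cast_nonneg _)).trans h2'
    linarith

lemma frequently_le_complexity (hm : Admissible m) (K : ℕ) :
    ∃ᶠ q : ℕ in atTop, (3 / 2 - 4 / 2 ^ K) * (q : ℝ) ≤
      complexity (factorSubshift (limitSeq m)) q := by
  rw [frequently_atTop]
  intro N
  set k := max K N + 1
  have hNk : N < height m k := lt_of_le_of_lt (le_max_right K N) (lt_height hm _)
  refine ⟨specialLength m k + 1, by have := height_le_specialLength hm k; omega, ?_⟩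
  have hK : (0 : ℝ) < 2 ^ K := by positivity
  have hm1 : (2 : ℝ) ^ K ≤ m (k + 1) :=
    (pow_le_pow_right₀ (by norm_num) (by omega)).trans (hm.two_pow_le (by omega))
  have h1 : m (k + 1) * height m k ≤ specialLength m k + 1 := by
    have := hm.pos k
    have h2 : m (k + 1) * height m k ≤ (2 * m (k + 1) - 1) * height m k :=
      Nat.mul_le_mul_right _ (by omega)
    unfold specialLength
    omega
  have h1' : (m (k + 1) : ℝ) * height m k ≤ (specialLength m k + 1 : ℕ) := by exact_mod_cast h1
  have hd : (height m k : ℝ) ≤ (specialLength m k + 1 : ℕ) / 2 ^ K := by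
    rw [le_div_iff₀ hK, mul_comm]
    exact (mul_le_mul_of_nonneg_right hm1 (Nat.cast_nonneg _)).trans h1'
  have h2 := le_complexity_specialLength hm (k := k) (by omega)
  have h3 := specialLength_le hm k
  have h2' : (3 : ℝ) * m (k + 1) * height m k ≤
      complexity (factorSubshift (limitSeq m)) (specialLength m k + 1) + 4 * height m k := by
    exact_mod_cast h2
  have h3' : ((specialLength m k + 1 : ℕ) : ℝ) ≤ 2 * m (k + 1) * height m k := by
    exact_mod_cast h3
  have hgoal : (3 / 2 - 4 / 2 ^ K) * ((specialLength m k + 1 : ℕ) : ℝ) =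
    3 / 2 * ((specialLength m k + 1 : ℕ) : ℝ) -
      4 * ((specialLength m k + 1 : ℕ) / 2 ^ K) := by ring
  rw [hgoal]
  linarith

lemma tendsto_coe_add_div_two_pow (a b : ℝ) :
    Tendsto (fun K : ℕ => ((a + b / 2 ^ K : ℝ) : EReal)) atTop (nhds (a : EReal)) := by
  refine (continuous_coe_real_ereal.tendsto a).comp ?_
  have h := (tendsto_pow_atTop_nhds_zero_of_lt_one (r := (1 / 2 : ℝ)) (by norm_num)
    (by norm_num)).const_mul b
  have h2 := h.const_add a
  simp only [mul_zero, add_zero] at h2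
  refine h2.congr fun K => ?_
  simp [div_eq_mul_inv]

lemma limsup_complexity_div (hm : Admissible m) :
    limsup (fun q : ℕ =>
      (((complexity (factorSubshift (limitSeq m)) q : ℝ) / (q : ℝ) : ℝ) : EReal)) atTop =
      ((3 / 2 : ℝ) : EReal) := by
  apply le_antisymm
  · refine ge_of_tendsto' (tendsto_coe_add_div_two_pow (3 / 2) 5) fun K => ?_
    refine limsup_le_of_le (h := ?_)
    filter_upwards [eventually_complexity_le hm K, eventually_gt_atTop 0] with q hq hq0
    rw [EReal.coe_le_coe_iff, div_le_iff₀ (by exact_mod_cast hq0)]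
    exact hq
  · refine le_of_tendsto' (tendsto_coe_add_div_two_pow (3 / 2) (-4)) fun K => ?_
    refine le_limsup_of_frequently_le ?_
    refine ((frequently_le_complexity hm K).and_eventually (eventually_gt_atTop 0)).mono ?_
    rintro q ⟨hq, hq0⟩
    rw [EReal.coe_le_coe_iff, le_div_iff₀ (by exact_mod_cast hq0), neg_div, ← sub_eq_add_neg]
    exact hq

lemma infinite_factorSubshift (hm : Admissible m) :
    (factorSubshift (limitSeq m)).carrier.Infinite := by
  intro hfin
  set X := factorSubshift (limitSeq m)
  have h := le_complexity hm (X.carrier.ncard + 1)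
  have hsub : languageOfLength X (X.carrier.ncard + 1) ⊆
      (fun (x : ℤ → Fin 2) (j : Fin (X.carrier.ncard + 1)) => x (j : ℕ)) '' X.carrier := by
    rintro w ⟨x, hx, i, hw⟩
    exact ⟨shift i x, X.mapsTo i hx, funext hw⟩
  have h2 := (Set.ncard_le_ncard hsub (hfin.image _)).trans (Set.ncard_image_le hfin)
  change _ ≤ (languageOfLength X _).ncard at h
  omega

end Limsup

/-! ### Choice of the parameters with prime heights. -/

section Parameters

/-- Dirichlet's theorem provides prime heights for arbitrarily large parameters. -/
lemma exists_prime_height (d e N : ℕ) (hd : 0 < d) (hde : d.Coprime e) :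
    ∃ M, N < M ∧ 2 ≤ M ∧ ((M - 1) * d + e).Prime := by
  have : NeZero d := ⟨hd.ne'⟩
  obtain ⟨p, hp, hpp, heq⟩ := Nat.forall_exists_prime_gt_and_eq_mod
    (q := d) (a := (e : ZMod d)) ((ZMod.isUnit_iff_coprime e d).2 hde.symm) (e + (N + 1) * d)
  have hmod : e ≡ p [MOD d] := ((ZMod.natCast_eq_natCast_iff _ _ _).1 heq).symm
  obtain ⟨t, ht⟩ := (Nat.modEq_iff_dvd' (by omega)).1 hmod
  have hpt : p = t * d + e := by rw [mul_comm t d, ← ht]; omega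
  have hNt : N + 1 < t := by
    by_contra h
    have := Nat.mul_le_mul_right d (not_lt.1 h)
    omega
  exact ⟨t + 1, by omega, by omega, by rwa [Nat.add_sub_cancel, ← hpt]⟩

/-- The second number is the first plus M d, and the prime exceeds both M and d. For d = 1 this
needs e ≥ 2. Coprimality thus persists, and Dirichlet's theorem applies again. -/
lemma coprime_of_prime_height {d e M : ℕ} (hd : 0 < d) (he : 2 ≤ e) (hM : 2 ≤ M)
    (hp : ((M - 1) * d + e).Prime) : ((M - 1) * d + e).Coprime ((2 * M - 1) * d + e) := by
  obtain ⟨a, rfl⟩ := Nat.exists_eq_add_of_le' hM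
  have h1 : (2 * (a + 2) - 1) * d + e = (a + 2) * d + ((a + 2 - 1) * d + e) := by
    rw [show 2 * (a + 2) - 1 = (a + 2) + (a + 1) by omega, show a + 2 - 1 = a + 1 by omega]; ring
  rw [h1, Nat.coprime_add_self_right, hp.coprime_iff_not_dvd, hp.dvd_mul]
  rw [show a + 2 - 1 = a + 1 by omega]
  have h2 : 0 < a * d + 1 := Nat.succ_pos _
  rintro (h | h)
  · have := Nat.le_of_dvd (by omega) h
    nlinarith
  · have := Nat.le_of_dvd hd h
    nlinarith

theorem exists_admissible : ∃ m : ℕ → ℕ, Admissible m ∧ StrictMonoOn m (Set.Ici 1) := by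
  choose! f hf1 hf2 hf3 using exists_prime_height
  -- The triple is m_k, |u_k|, |v_k|. The first step is forced by m 1 = 1 and gives lengths 1 and 2.
  -- Later the maximum secures both monotonicity and the growth condition.
  let st : ℕ → ℕ × ℕ × ℕ := fun k => Nat.rec (0, 1, 1) (fun k s =>
    if k = 0 then (1, 1, 2) else
      let M := f s.2.1 s.2.2 (max s.1 (2 ^ (k + 2)))
      (M, (M - 1) * s.2.1 + s.2.2, (2 * M - 1) * s.2.1 + s.2.2)) k
  have h1 : st 1 = (1, 1, 2) := rfl
  have hsucc : ∀ k, 1 ≤ k → st (k + 1) =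
      (f (st k).2.1 (st k).2.2 (max (st k).1 (2 ^ (k + 2))),
        (f (st k).2.1 (st k).2.2 (max (st k).1 (2 ^ (k + 2))) - 1) * (st k).2.1 + (st k).2.2,
        (2 * f (st k).2.1 (st k).2.2 (max (st k).1 (2 ^ (k + 2))) - 1) * (st k).2.1 +
          (st k).2.2) := by
    intro k hk
    change (if k = 0 then _ else _) = _
    rw [if_neg (by omega)]
  have hinv : ∀ k, 1 ≤ k → 0 < (st k).2.1 ∧ 2 ≤ (st k).2.2 ∧ (st k).2.1.Coprime (st k).2.2 := by
    intro k hk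
    induction k, hk using Nat.le_induction with
    | base => rw [h1]; decide
    | succ k hk ih =>
      obtain ⟨i1, i2, i3⟩ := ih
      rw [hsucc k hk]
      exact ⟨by positivity, by simp only; omega, coprime_of_prime_height i1 i2 (hf2 _ _ _ i1 i3)
        (hf3 _ _ _ i1 i3)⟩
  set m : ℕ → ℕ := fun k => (st k).1 with hm
  have hlen : ∀ k, 1 ≤ k → height m k = (st k).2.1 ∧ (oneWord m k).length = (st k).2.2 := by
    intro k hk
    induction k, hk using Nat.le_induction with
    | base =>
      rw [h1]
      exact ⟨rfl, rfl⟩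
    | succ k hk ih =>
      have e1 := height_succ (m := m) k
      have e2 : (oneWord m (k + 1)).length =
          (2 * m (k + 1) - 1) * height m k + (oneWord m k).length := by
        simp [oneWord_succ, height]
      rw [e1, e2, ih.1, ih.2]
      simp only [hm, hsucc k hk, and_self]
  have hlt : ∀ k, 1 ≤ k → max (m k) (2 ^ (k + 2)) < m (k + 1) := by
    intro k hk
    obtain ⟨i1, i2, i3⟩ := hinv k hk
    have := hf1 _ _ (max (st k).1 (2 ^ (k + 2))) i1 i3
    simp only [hm, hsucc k hk]
    exact this
  refine ⟨m, ⟨rfl, fun k hk => ?_, fun k hk => ?_⟩, ?_⟩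
  · obtain ⟨l, rfl⟩ := Nat.exists_eq_add_of_le' (show 1 ≤ k by omega)
    exact (le_max_right _ _).trans (hlt l (by omega)).le
  · obtain ⟨l, rfl⟩ := Nat.exists_eq_add_of_le' (show 1 ≤ k by omega)
    obtain ⟨i1, i2, i3⟩ := hinv l (by omega)
    rw [(hlen _ (by omega)).1, hsucc l (by omega)]
    exact hf3 _ _ _ i1 i3
  · exact strictMonoOn_of_lt_succ Set.ordConnected_Ici fun k _ hk _ =>
      (le_max_left _ _).trans_lt (hlt k hk)

lemma Admissible.summable {m : ℕ → ℕ} (hm : Admissible m) :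
    Summable fun k : ℕ => (1 : ℝ) / m k := by
  rw [← summable_nat_add_iff 2]
  refine Summable.of_nonneg_of_le (fun k => by positivity) (fun k => ?_) summable_geometric_two
  have h := hm.two_pow_le (k := k + 2) (by omega)
  have h2 : (2 : ℝ) ^ k ≤ 2 ^ (k + 2) := pow_le_pow_right₀ (by norm_num) (by omega)
  rw [one_div_pow]
  exact one_div_le_one_div_of_le (by positivity) (h2.trans h)

end Parameters

/-! ### Geometric sums and two lemmas on real sequences. -/

section GeometricSums

lemma norm_geom_sum_le {z : ℂ} (hz : ‖z‖ = 1) (M : ℕ) : ‖∑ l ∈ Finset.range M, z ^ l‖ ≤ M := by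
  refine (norm_sum_le _ _).trans ?_
  simp [hz]

/-- Pairing z^l with z^(l+i) extracts the factor 1 + z^i from the first 2i terms. -/
lemma norm_geom_sum_le_of_two_mul_le {z : ℂ} (hz : ‖z‖ = 1) {i M : ℕ} (hi : 2 * i ≤ M) :
    ‖∑ l ∈ Finset.range M, z ^ l‖ ≤ ‖1 + z ^ i‖ * i + (M - 2 * i) := by
  obtain ⟨r, rfl⟩ := Nat.exists_eq_add_of_le hi
  have h1 : ∑ l ∈ Finset.range (2 * i + r), z ^ l =
      (1 + z ^ i) * ∑ l ∈ Finset.range i, z ^ l +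
        z ^ (2 * i) * ∑ l ∈ Finset.range r, z ^ l := by
    rw [Finset.sum_range_add, two_mul, Finset.sum_range_add, add_mul, one_mul]
    simp only [pow_add, Finset.mul_sum]
  rw [h1]
  refine (norm_add_le _ _).trans ?_
  rw [norm_mul, norm_mul, norm_pow, hz, one_pow, one_mul]
  refine add_le_add (mul_le_mul_of_nonneg_left (norm_geom_sum_le hz i) (norm_nonneg _)) ?_
  refine (norm_geom_sum_le hz r).trans ?_
  push_cast
  linarith

lemma norm_sub_one_sq {w : ℂ} (hw : ‖w‖ = 1) : ‖w - 1‖ ^ 2 = 4 - ‖1 + w‖ ^ 2 := by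
  have h : w.re ^ 2 + w.im ^ 2 = 1 := by
    have := Complex.sq_norm w
    rw [hw, Complex.normSq_apply] at this
    linarith
  rw [Complex.sq_norm, Complex.sq_norm, Complex.normSq_apply, Complex.normSq_apply]
  simp only [Complex.sub_re, Complex.one_re, Complex.sub_im, Complex.one_im, Complex.add_re,
    Complex.add_im]
  linarith

/-- If a geometric sum of length `M` is almost as large as possible, then `z` is close to `1`. -/
lemma norm_sub_one_mul_le {z : ℂ} {M : ℕ} (hM : 0 < M)
    (h : (1 / 2 : ℝ) * M ≤ ‖∑ l ∈ Finset.range M, z ^ l‖) :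
    ‖z - 1‖ ≤ 2 * ‖z ^ M - 1‖ / M := by
  have hM' : (0 : ℝ) < M := by exact_mod_cast hM
  rw [le_div_iff₀ hM', ← geom_sum_mul, norm_mul]
  nlinarith [norm_nonneg (z - 1)]

/-- Pairing at distance i = M / 2 forces |1 + z^i| close to 2, so z^i and z^(2i) are close to 1. The
term 4 / M bounds |z - 1| and covers odd M. -/
lemma norm_pow_sub_one_le {z : ℂ} (hz : ‖z‖ = 1) {M : ℕ} (hM : 2 ≤ M) {η : ℝ} (hη : 0 ≤ η)
    (hη' : η ≤ 1 / 2) (h : (1 - η) * M ≤ ‖∑ l ∈ Finset.range M, z ^ l‖) :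
    ‖z ^ M - 1‖ ≤ 2 * Real.sqrt (12 * η) + 4 / M := by
  have hM' : (0 : ℝ) < M := by exact_mod_cast (by omega : 0 < M)
  have h1 : ‖z - 1‖ ≤ 4 / M := by
    refine (norm_sub_one_mul_le (by omega) (le_trans ?_ h)).trans ?_
    · nlinarith
    · refine div_le_div_of_nonneg_right ?_ hM'.le
      have : ‖z ^ M - 1‖ ≤ 2 := by
        refine (norm_sub_le _ _).trans ?_
        rw [norm_pow, hz, one_pow, norm_one]; norm_num
      linarith
  set i := M / 2
  have hi : 2 * i ≤ M := by omega
  have hi3 : M ≤ 3 * i := by omega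
  have hi0 : (0 : ℝ) < i := by exact_mod_cast (by omega : 0 < i)
  have hi3' : (M : ℝ) ≤ 3 * i := by exact_mod_cast hi3
  have hw : ‖z ^ i‖ = 1 := by rw [norm_pow, hz, one_pow]
  have h2 : 2 - 3 * η ≤ ‖1 + z ^ i‖ := by
    have h3 := h.trans (norm_geom_sum_le_of_two_mul_le hz hi)
    have h4 : η * M ≤ η * (3 * i) := mul_le_mul_of_nonneg_left hi3' hη
    by_contra hcon
    have h5 := mul_lt_mul_of_pos_right (not_le.1 hcon) hi0
    nlinarith
  have h3 : ‖z ^ i - 1‖ ≤ Real.sqrt (12 * η) := by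
    refine Real.le_sqrt_of_sq_le ?_
    rw [norm_sub_one_sq hw]
    nlinarith
  have h4 : ‖z ^ (2 * i) - 1‖ ≤ 2 * Real.sqrt (12 * η) := by
    have : z ^ (2 * i) - 1 = z ^ i * (z ^ i - 1) + (z ^ i - 1) := by ring
    rw [this]
    refine (norm_add_le _ _).trans ?_
    rw [norm_mul, hw]
    linarith
  have h0 : (0 : ℝ) ≤ 4 / M := by positivity
  rcases (show M = 2 * i ∨ M = 2 * i + 1 by omega) with hM2 | hM2
  · rw [hM2] at h0 ⊢
    linarith
  · have : z ^ M - 1 = z * (z ^ (2 * i) - 1) + (z - 1) := by rw [hM2]; ring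
    rw [this]
    refine (norm_add_le _ _).trans ?_
    rw [norm_mul, hz]
    linarith

/-- A null sequence satisfying a perturbed monotonicity inequality vanishes. -/
lemma eq_zero_of_le_add_div_two_pow {h : ℕ → ℝ} (h0 : ∀ k, 0 ≤ h k)
    (hlim : Tendsto h atTop (nhds 0)) {k₀ : ℕ}
    (hle : ∀ k, k₀ ≤ k → h k ≤ h (k + 1) + h (k + 2) / 2 ^ (k + 3)) {k : ℕ} (hk : k₀ ≤ k) :
    h k = 0 := by
  refine le_antisymm (le_of_forall_pos_le_add fun ε hε => ?_) (h0 k)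
  obtain ⟨K, hK⟩ := eventually_atTop.1 (hlim.eventually (gt_mem_nhds (half_pos hε)))
  -- Induction downwards from `K`; the growth of the weight 1 + 1 / 2^l from l + 1 to l pays for the
  -- perturbation.
  have key : ∀ n l, k₀ ≤ l → K ≤ l + n → h l ≤ ε / 2 * (1 + 1 / 2 ^ l) := by
    intro n
    induction n with
    | zero =>
      intro l _ hl
      have h1 := (hK l (by omega)).le
      have : 0 ≤ ε / 2 * (1 / 2 ^ l) := by positivity
      linarith
    | succ n ih =>
      intro l hl hKl
      have h1 := ih (l + 1) (by omega) (by omega)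
      have h2 := ih (l + 2) (by omega) (by omega)
      have h3 := hle l hl
      have h4 : h (l + 2) / 2 ^ (l + 3) ≤ ε / 2 * (1 + 1 / 2 ^ (l + 2)) / 2 ^ (l + 3) :=
        div_le_div_of_nonneg_right h2 (by positivity)
      have hx : (0 : ℝ) < 1 / 2 ^ l := by positivity
      have hx1 : (1 : ℝ) / 2 ^ l ≤ 1 := by
        rw [div_le_one (by positivity)]; exact one_le_pow₀ (by norm_num)
      have e1 : (1 : ℝ) / 2 ^ (l + 1) = 1 / 2 ^ l / 2 := by rw [pow_succ]; field_simp
      have e2 : (1 : ℝ) / 2 ^ (l + 2) = 1 / 2 ^ l / 4 := by rw [pow_add]; field_simp; norm_num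
      have e3 : ε / 2 * (1 + 1 / 2 ^ (l + 2)) / 2 ^ (l + 3) =
          ε / 2 * ((1 + 1 / 2 ^ l / 4) * (1 / 2 ^ l / 8)) := by
        rw [e2, pow_add]; field_simp; norm_num
      rw [e1] at h1
      rw [e3] at h4
      set x : ℝ := 1 / 2 ^ l
      have h5 : 1 + x / 2 + (1 + x / 4) * (x / 8) ≤ 1 + x := by nlinarith
      have h6 := mul_le_mul_of_nonneg_left h5 (half_pos hε).le
      linarith
  have h1 := key K k hk (by omega)
  have h2 : (1 : ℝ) / 2 ^ k ≤ 1 := by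
    rw [div_le_one (by positivity)]; exact one_le_pow₀ (by norm_num)
  nlinarith

/-- A contraction with summable errors. -/
lemma tendsto_zero_of_le_mul_add {t g e : ℕ → ℝ} (ht : ∀ k, 0 ≤ t k) (hg : ∀ k, g k ≤ 1)
    (he : Summable e) (he0 : ∀ k, 0 ≤ e k) (h : ∀ k, t (k + 1) ≤ g k * t k + e k) {η : ℝ}
    (hη : 0 < η) (hfreq : ∃ᶠ k in atTop, g k ≤ 1 - η) : Tendsto t atTop (nhds 0) := by
  -- Removing the accumulated errors makes the sequence antitone, so `t` converges; its limit L
  -- satisfies L ≤ (1 - η) L.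
  set s : ℕ → ℝ := fun k => t k - ∑ j ∈ Finset.range k, e j with hs
  have hanti : Antitone s := antitone_nat_of_succ_le fun k => by
    simp only [hs, Finset.sum_range_succ]
    have := mul_le_mul_of_nonneg_right (hg k) (ht k)
    have := h k
    linarith
  have hbdd : BddBelow (Set.range s) := by
    refine ⟨-∑' j, e j, ?_⟩
    rintro _ ⟨k, rfl⟩
    have := he.sum_le_tsum (Finset.range k) fun j _ => he0 j
    have := ht k
    simp only [hs]
    linarith
  have hlim : Tendsto t atTop (nhds ((⨅ k, s k) + ∑' j, e j)) := by
    refine ((tendsto_atTop_ciInf hanti hbdd).add he.hasSum.tendsto_sum_nat).congr fun k => ?_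
    simp [hs]
  set L := (⨅ k, s k) + ∑' j, e j
  have hL : 0 ≤ L := ge_of_tendsto' hlim ht
  have h1 : Tendsto (fun k => t (k + 1) - (1 - η) * t k - e k) atTop
      (nhds (L - (1 - η) * L - 0)) :=
    ((hlim.comp (tendsto_add_atTop_nat 1)).sub (hlim.const_mul _)).sub he.tendsto_atTop_zero
  have h2 : L - (1 - η) * L - 0 ≤ 0 := by
    refine le_of_tendsto_of_frequently h1 (hfreq.mono fun k hk => ?_)
    have := mul_le_mul_of_nonneg_right hk (ht k)
    have := h k
    linarith
  have h3 : L = 0 := by nlinarith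
  rwa [h3] at hlim

end GeometricSums

/-! ### Exclusion of nontrivial eigenvalues. -/

section Eigenvalues

variable {m : ℕ → ℕ}

lemma height_add_two (hm : Admissible m) (k : ℕ) :
    height m (k + 2) = m (k + 2) * height m (k + 1) + m (k + 1) * height m k := by
  have hp := hm.pos (k + 1)
  rw [height_succ, length_oneWord_succ hm]
  obtain ⟨a, ha⟩ := Nat.exists_eq_add_of_le' hp
  rw [ha, Nat.add_sub_cancel, Nat.succ_mul]
  omega

/-- A complex number of modulus one all of whose geometric sums along the heights are almost
maximal is equal to one. -/
lemma eq_one_of_geom_sum_large (hm : Admissible m) {c : ℂ} (hc : ‖c‖ = 1)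
    (h : ∀ η : ℝ, 0 < η → ∀ᶠ k in atTop,
      (1 - η) * m (k + 1) ≤ ‖∑ l ∈ Finset.range (m (k + 1)), (c ^ height m k) ^ l‖) : c = 1 := by
  have hz : ∀ k, ‖c ^ height m k‖ = 1 := fun k => by rw [norm_pow, hc, one_pow]
  set r : ℕ → ℝ := fun k => ‖(c ^ height m k) ^ m (k + 1) - 1‖ with hr
  have hr0 : ∀ k, 0 ≤ r k := fun k => norm_nonneg _
  have hinv : Tendsto (fun k => (4 : ℝ) / m (k + 1)) atTop (nhds 0) := by
    have := ((tendsto_add_atTop_iff_nat 1).2 hm.summable.tendsto_atTop_zero).const_mul 4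
    simpa [div_eq_mul_inv] using this
  have hlim : Tendsto r atTop (nhds 0) := by
    rw [Metric.tendsto_atTop']
    intro ε hε
    -- Chosen so that 2 √(12 η) ≤ ε / 2.
    set η : ℝ := min (1 / 2) (ε ^ 2 / 192) with hη
    have hη0 : 0 < η := by positivity
    have hsq : Real.sqrt (12 * η) ≤ ε / 4 := by
      rw [Real.sqrt_le_left (by positivity)]
      have := min_le_right (1 / 2 : ℝ) (ε ^ 2 / 192)
      nlinarith
    have h1 := (h η hη0).and ((hinv.eventually (gt_mem_nhds (half_pos hε))).and
      (eventually_ge_atTop 1))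
    obtain ⟨K, hK⟩ := eventually_atTop.1 h1
    refine ⟨K, fun k hk => ?_⟩
    obtain ⟨h2, h3, h4⟩ := hK k hk.le
    have h5 := norm_pow_sub_one_le (hz k)
      ((by norm_num : 2 ≤ 8).trans (hm.eight_le (k := k + 1) (by omega))) hη0.le
      (min_le_left _ _) h2
    rw [Real.dist_eq, sub_zero, abs_of_nonneg (hr0 k)]
    simp only [hr]
    linarith
  obtain ⟨k₁, hk₁⟩ := eventually_atTop.1 (h (1 / 2) (by norm_num))
  have hsmall : ∀ k, k₁ ≤ k → ‖c ^ height m k - 1‖ ≤ 2 * r k / m (k + 1) := fun k hk =>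
    norm_sub_one_mul_le (hm.pos k) (by have := hk₁ k hk; norm_num at this ⊢; exact this)
  -- The height recurrence bounds `r k` by `r (k + 1)` plus |c^(d_{k+2}) - 1|, and the latter is at
  -- most 2 r (k + 2) / m (k + 3).
  have hle : ∀ k, k₁ ≤ k → r k ≤ r (k + 1) + r (k + 2) / 2 ^ (k + 3) := by
    intro k hk
    have h1 : c ^ height m (k + 2) =
        (c ^ height m (k + 1)) ^ m (k + 2) * (c ^ height m k) ^ m (k + 1) := by
      rw [height_add_two hm, pow_add, ← pow_mul, ← pow_mul, mul_comm (m (k + 2)),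
        mul_comm (m (k + 1))]
    have h2 : r k ≤ r (k + 1) + ‖c ^ height m (k + 2) - 1‖ := by
      simp only [hr]
      set a := (c ^ height m (k + 1)) ^ m (k + 1 + 1) with ha
      set b := (c ^ height m k) ^ m (k + 1)
      have hna : ‖a‖ = 1 := by rw [ha, norm_pow, hz, one_pow]
      have h3 : ‖b - 1‖ = ‖(c ^ height m (k + 2) - 1) - (a - 1)‖ := by
        rw [h1, sub_sub_sub_cancel_right, ← mul_sub_one, norm_mul, hna, one_mul]
      have h4 := norm_sub_le (c ^ height m (k + 2) - 1) (a - 1)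
      rw [h3]
      linarith
    refine h2.trans (add_le_add_right ((hsmall (k + 2) (by omega)).trans ?_) _)
    have h4 : (2 : ℝ) ^ (k + 4) ≤ m (k + 2 + 1) := by
      exact_mod_cast hm.large (k + 3) (by omega)
    have h5 : (0 : ℝ) < 2 ^ (k + 3) := by positivity
    calc 2 * r (k + 2) / m (k + 2 + 1) ≤ 2 * r (k + 2) / 2 ^ (k + 4) :=
          div_le_div_of_nonneg_left (by have := hr0 (k + 2); positivity) (by positivity) h4
      _ = r (k + 2) / 2 ^ (k + 3) := by rw [pow_succ _ (k + 3)]; field_simp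
  have hone : ∀ k, k₁ ≤ k → c ^ height m k = 1 := by
    intro k hk
    have h1 := hsmall k hk
    rw [eq_zero_of_le_add_div_two_pow hr0 hlim hle hk, mul_zero, zero_div] at h1
    exact sub_eq_zero.1 (norm_le_zero_iff.1 h1)
  set k := max k₁ 2
  have hk2 : 2 ≤ k := le_max_right _ _
  have hlt : height m k < height m (k + 1) := by
    have h1 := mul_height_le hm k
    have h2 := hm.eight_le (k := k + 1) (by omega)
    have h3 := Nat.mul_le_mul_right (height m k) h2
    have h4 := height_pos hm k
    omega
  have hcop : (height m k).Coprime (height m (k + 1)) :=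
    (Nat.coprime_primes (hm.prime k hk2) (hm.prime (k + 1) (by omega))).2 hlt.ne
  have h1 := Nat.dvd_gcd (orderOf_dvd_of_pow_eq_one (hone k (le_max_left _ _)))
    (orderOf_dvd_of_pow_eq_one (hone (k + 1) ((le_max_left _ _).trans (Nat.le_succ _))))
  rw [hcop, Nat.dvd_one] at h1
  exact orderOf_eq_one_iff.1 h1

end Eigenvalues

/-! ### Twisted quasi-additive functions on words. -/

section QuasiAdditive

variable {A : Type*}

/-- A function on words that is additive under concatenation, up to the twist by powers of `c` and
up to a bounded error. -/
structure IsQuasiAdditive (c : ℂ) (F : List A → ℂ) (R B : ℝ) : Prop where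
  norm_le : ∀ w, ‖F w‖ ≤ B * w.length
  norm_append_le : ∀ w w', ‖F (w ++ w') - (F w + c ^ w.length * F w')‖ ≤ R

namespace IsQuasiAdditive

variable {c : ℂ} {F : List A → ℂ} {R B : ℝ}

lemma map_nil (h : IsQuasiAdditive c F R B) : F [] = 0 := by
  simpa using h.norm_le []

lemma error_nonneg (h : IsQuasiAdditive c F R B) : 0 ≤ R :=
  (norm_nonneg _).trans (h.norm_append_le [] [])

lemma norm_wordPow_sub_le (h : IsQuasiAdditive c F R B) (w : List A) (j : ℕ) :
    ‖F (wordPow w j) - (∑ l ∈ Finset.range j, (c ^ w.length) ^ l) * F w‖ ≤ j * R := by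
  induction j with
  | zero => simp [h.map_nil]
  | succ j ih =>
    have h1 := h.norm_append_le (wordPow w j) w
    rw [← wordPow_succ', length_wordPow, mul_comm j, pow_mul] at h1
    rw [Finset.sum_range_succ]
    have h2 : F (wordPow w (j + 1)) -
        (∑ l ∈ Finset.range j, (c ^ w.length) ^ l + (c ^ w.length) ^ j) * F w =
        (F (wordPow w (j + 1)) - (F (wordPow w j) + (c ^ w.length) ^ j * F w)) +
        (F (wordPow w j) - (∑ l ∈ Finset.range j, (c ^ w.length) ^ l) * F w) := by ring
    rw [h2]
    refine (norm_add_le _ _).trans ?_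
    push_cast
    linarith

lemma norm_append_le_add (h : IsQuasiAdditive c F R B) (hc : ‖c‖ = 1) (w w' : List A) :
    ‖F (w ++ w')‖ ≤ ‖F w‖ + ‖F w'‖ + R := by
  have h1 := h.norm_append_le w w'
  have h2 := norm_add_le (F w) (c ^ w.length * F w')
  rw [norm_mul, norm_pow, hc, one_pow, one_mul] at h2
  have h3 := norm_le_norm_sub_add (F (w ++ w')) (F w + c ^ w.length * F w')
  linarith

lemma norm_wordPow_le (h : IsQuasiAdditive c F R B) (hc : ‖c‖ = 1) (w : List A) (j : ℕ) :
    ‖F (wordPow w j)‖ ≤ j * (‖F w‖ + R) := by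
  induction j with
  | zero => simp [h.map_nil]
  | succ j ih =>
    have h1 := h.norm_append_le_add hc (wordPow w j) w
    rw [← wordPow_succ'] at h1
    push_cast
    linarith

lemma norm_flatMap_le {C : Type*} (h : IsQuasiAdditive c F R B) (hc : ‖c‖ = 1) {ρ : C → List A}
    {α : ℝ} (hρ : ∀ a, ‖F (ρ a)‖ + R ≤ α * (ρ a).length) (s : List C) :
    ‖F (s.flatMap ρ)‖ ≤ α * (s.flatMap ρ).length := by
  induction s with
  | nil => simp [h.map_nil]
  | cons a s ih =>
    have h1 := h.norm_append_le_add hc (ρ a) (s.flatMap ρ)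
    have h2 := hρ a
    rw [List.flatMap_cons, List.length_append]
    push_cast
    linarith

end IsQuasiAdditive

/-- The word of length `n` at position `i` of a one-sided sequence, as a list. -/
def window (y : ℕ → A) (i n : ℕ) : List A := List.ofFn (factor y n i)

@[simp] lemma length_window (y : ℕ → A) (i n : ℕ) : (window y i n).length = n := by
  simp [window]

lemma window_infix {y : ℕ → A} {w : List A} (h : OccursAt y w 0) {i n : ℕ}
    (hin : i + n ≤ w.length) : window y i n <:+: w := by
  have h1 : window y i n = (w.drop i).take n := by
    apply List.ext_getElem
    · simp; omega
    · intro j hj hj'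
      have hjn : j < n := by simpa using hj
      have h2 := h (i + j) (by omega)
      rw [List.getElem?_eq_getElem (by omega), Option.some_inj, zero_add] at h2
      simp [window, factor, h2]
  rw [h1]
  exact (List.take_prefix _ _).isInfix.trans (List.drop_suffix _ _).isInfix

variable {m : ℕ → ℕ} {c : ℂ} {F : List (Fin 2) → ℂ} {R B : ℝ}

lemma summable_inv_height (hm : Admissible m) : Summable fun k => (1 : ℝ) / height m k := by
  refine Summable.of_nonneg_of_le (fun k => by positivity) (fun k => ?_)
    (summable_geometric_two.mul_left 2)
  cases k with
  | zero => simp [height]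
  | succ k =>
    have h : (2 : ℝ) ^ k ≤ height m (k + 1) := by exact_mod_cast two_pow_le_height hm k
    calc (1 : ℝ) / height m (k + 1) ≤ 1 / 2 ^ k := one_div_le_one_div_of_le (by positivity) h
      _ = 2 * (1 / 2) ^ (k + 1) := by rw [pow_succ, one_div_pow]; ring

lemma summable_inv_succ (hm : Admissible m) : Summable fun k => (1 : ℝ) / m (k + 1) :=
  (summable_nat_add_iff 1).2 hm.summable

/-- If the averages over the words `zeroWord m k` tend to zero, then so do the averages over all
factors, uniformly. -/
lemma IsQuasiAdditive.eventually_norm_window_le (h : IsQuasiAdditive c F R B) (hm : Admissible m)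
    (hc : ‖c‖ = 1)
    (hlim : Tendsto (fun k => ‖F (zeroWord m k)‖ / height m k) atTop (nhds 0)) {ε : ℝ}
    (hε : 0 < ε) :
    ∀ᶠ n : ℕ in atTop, ∀ i, ‖F (window (limitSeq m) i n)‖ ≤ ε * n := by
  have hR := h.error_nonneg
  have hd : ∀ k, (0 : ℝ) < height m k := fun k => by exact_mod_cast height_pos hm k
  have hlim' : Tendsto (fun k => ‖F (zeroWord m k)‖ / height m k + 2 * R * (1 / height m k)) atTop
      (nhds 0) := by
    simpa using hlim.add ((summable_inv_height hm).tendsto_atTop_zero.const_mul (2 * R))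
  obtain ⟨K, hK⟩ := eventually_atTop.1 (hlim'.eventually (gt_mem_nhds (half_pos hε)))
  -- One `R` pays for the join inside v_{K+1} = u_K^m u_{K+1}, the other for joining consecutive
  -- blocks.
  have hzero : ∀ k, K ≤ k → ‖F (zeroWord m k)‖ + 2 * R ≤ ε / 2 * height m k := by
    intro k hk
    have h1 := hK k hk
    have h2 : ‖F (zeroWord m k)‖ / height m k + 2 * R * (1 / height m k) =
        (‖F (zeroWord m k)‖ + 2 * R) / height m k := by ring
    rw [h2, div_lt_iff₀ (hd k)] at h1
    exact h1.le
  have hone : ‖F (oneWord m (K + 1))‖ + R ≤ ε / 2 * (oneWord m (K + 1)).length := by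
    have h1 := hzero K le_rfl
    have h2 := hzero (K + 1) (by omega)
    have h3 := h.norm_append_le_add hc (wordPow (zeroWord m K) (m (K + 1))) (zeroWord m (K + 1))
    rw [← oneWord_succ_eq hm] at h3
    have h4 := h.norm_wordPow_le hc (zeroWord m K) (m (K + 1))
    have h5 : (m (K + 1) : ℝ) * (‖F (zeroWord m K)‖ + R) ≤ m (K + 1) * (ε / 2 * height m K) :=
      mul_le_mul_of_nonneg_left (by linarith) (Nat.cast_nonneg _)
    rw [length_oneWord_succ hm]
    push_cast
    linarith
  have hρ : ∀ a, ‖F (rho m (fun k => 2 * m k) (K + 1) a)‖ + R ≤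
      ε / 2 * (rho m (fun k => 2 * m k) (K + 1) a).length := by
    intro a
    fin_cases a
    · have := hzero (K + 1) (by omega)
      change ‖F (zeroWord m (K + 1))‖ + R ≤ ε / 2 * height m (K + 1)
      linarith
    · exact hone
  set E := 2 * height m (K + 1) with hE
  obtain ⟨N, hN⟩ := exists_nat_ge ((2 * |B| * E + 2 * R) / (ε / 2))
  filter_upwards [eventually_ge_atTop N] with n hn i
  obtain ⟨s, hs⟩ := rho_eq_flatMap (m := m) (n := fun k => 2 * m k)
    (show K + 1 ≤ i + n + K + 1 by omega)
  have hinf : window (limitSeq m) i n <:+: (s 0).flatMap (rho m (fun k => 2 * m k) (K + 1)) := by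
    rw [← hs 0]
    refine window_infix (occursAt_zeroWord_zero hm (by omega : 1 ≤ i + n + K + 1)) ?_
    have := lt_height hm (i + n + K)
    unfold height at this
    omega
  obtain ⟨a, s', b, hw, ha, hb⟩ := exists_infix_flatMap _ E (length_rho_le hm (K + 1)) _ _ hinf
  have hshort : ∀ w : List (Fin 2), w.length ≤ E → ‖F w‖ ≤ |B| * E := by
    intro w hw
    have hw' : (w.length : ℝ) ≤ E := by exact_mod_cast hw
    calc ‖F w‖ ≤ B * w.length := h.norm_le w
      _ ≤ |B| * w.length := mul_le_mul_of_nonneg_right (le_abs_self B) (Nat.cast_nonneg _)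
      _ ≤ |B| * E := mul_le_mul_of_nonneg_left hw' (abs_nonneg B)
  have h1 := h.norm_append_le_add hc (a ++ s'.flatMap (rho m (fun k => 2 * m k) (K + 1))) b
  have h2 := h.norm_append_le_add hc a (s'.flatMap (rho m (fun k => 2 * m k) (K + 1)))
  have h3 := h.norm_flatMap_le hc hρ s'
  have h4 : ((s'.flatMap (rho m (fun k => 2 * m k) (K + 1))).length : ℝ) ≤ n := by
    have := congrArg List.length hw
    rw [length_window, List.length_append, List.length_append] at this
    exact_mod_cast (by omega)
  have h5 := mul_le_mul_of_nonneg_left h4 (half_pos hε).le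
  have h6 : 2 * |B| * E + 2 * R ≤ ε / 2 * n := by
    have : (N : ℝ) ≤ n := by exact_mod_cast hn
    have := hN.trans this
    rw [div_le_iff₀ (half_pos hε)] at this
    linarith
  have h7 := hshort a ha
  have h8 := hshort b hb
  rw [hw]
  linarith

lemma IsQuasiAdditive.norm_oneWord_le (h : IsQuasiAdditive c F R B) (hm : Admissible m)
    (hB : 0 ≤ B) (k : ℕ) : ‖F (oneWord m k)‖ ≤ 2 * B * height m k := by
  have h1 : ((oneWord m k).length : ℝ) ≤ 2 * height m k := by
    exact_mod_cast length_oneWord_le hm k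
  have := mul_le_mul_of_nonneg_left h1 hB
  linarith [h.norm_le (oneWord m k)]

/-- Treating the final v_k of u_{k+1} as another u_k costs at most 3 B d_k, since |v_k| ≤ 2 d_k. -/
lemma IsQuasiAdditive.norm_zeroWord_succ_sub_le (h : IsQuasiAdditive c F R B) (hm : Admissible m)
    (hc : ‖c‖ = 1) (hB : 0 ≤ B) (k : ℕ) :
    ‖F (zeroWord m (k + 1)) -
      (∑ l ∈ Finset.range (m (k + 1)), (c ^ height m k) ^ l) * F (zeroWord m k)‖ ≤
      m (k + 1) * R + 3 * B * height m k := by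
  obtain ⟨M, hM⟩ := Nat.exists_eq_add_of_le' (hm.pos k)
  have h1 := h.norm_append_le (wordPow (zeroWord m k) M) (oneWord m k)
  have h2 := h.norm_wordPow_sub_le (zeroWord m k) M
  have h3 := h.norm_oneWord_le hm hB k
  have h4 : ‖F (zeroWord m k)‖ ≤ B * height m k := h.norm_le _
  rw [hM, Finset.sum_range_succ, zeroWord_succ, hM, Nat.add_sub_cancel]
  change ‖F (wordPow (zeroWord m k) M) -
    (∑ l ∈ Finset.range M, (c ^ height m k) ^ l) * F (zeroWord m k)‖ ≤ M * R at h2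
  set w := wordPow (zeroWord m k) M
  have h5 : F (w ++ oneWord m k) - (∑ l ∈ Finset.range M, (c ^ height m k) ^ l +
      (c ^ height m k) ^ M) * F (zeroWord m k) =
      (F (w ++ oneWord m k) - (F w + c ^ w.length * F (oneWord m k))) +
      (F w - (∑ l ∈ Finset.range M, (c ^ height m k) ^ l) * F (zeroWord m k)) +
      (c ^ w.length * F (oneWord m k) - (c ^ height m k) ^ M * F (zeroWord m k)) := by ring
  rw [h5]
  have h6 := norm_sub_le (c ^ w.length * F (oneWord m k))
    ((c ^ height m k) ^ M * F (zeroWord m k))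
  rw [norm_mul, norm_mul, norm_pow, norm_pow, norm_pow, hc, one_pow, one_pow, one_pow, one_mul,
    one_mul] at h6
  refine (norm_add₃_le).trans ?_
  push_cast
  linarith

/-- Normalizing by m_{k+1} d_k leaves a factor at most 1 and summable errors. As c ≠ 1, the factor
is infinitely often bounded away from 1. -/
lemma IsQuasiAdditive.tendsto_of_ne_one (h : IsQuasiAdditive c F R B) (hm : Admissible m)
    (hc : ‖c‖ = 1) (hc1 : c ≠ 1) (hB : 0 ≤ B) :
    Tendsto (fun k => ‖F (zeroWord m k)‖ / height m k) atTop (nhds 0) := by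
  have hR := h.error_nonneg
  have hd : ∀ k, (0 : ℝ) < height m k := fun k => by exact_mod_cast height_pos hm k
  have hmp : ∀ k, (0 : ℝ) < m (k + 1) := fun k => by exact_mod_cast hm.pos k
  obtain ⟨η, hη, hfreq⟩ : ∃ η : ℝ, 0 < η ∧ ∃ᶠ k in atTop,
      ‖∑ l ∈ Finset.range (m (k + 1)), (c ^ height m k) ^ l‖ / m (k + 1) ≤ 1 - η := by
    by_contra hcon
    push Not at hcon
    refine hc1 (eq_one_of_geom_sum_large hm hc fun η hη => ?_)
    filter_upwards [hcon η hη] with k hk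
    rw [lt_div_iff₀ (hmp k)] at hk
    exact hk.le
  refine tendsto_zero_of_le_mul_add (e := fun k => R * (1 / height m k) + 3 * B * (1 / m (k + 1)))
    (fun k => by positivity) (fun k => ?_)
    (((summable_inv_height hm).mul_left _).add ((summable_inv_succ hm).mul_left _))
    (fun k => by positivity) (fun k => ?_) hη hfreq
  · rw [div_le_one (hmp k)]
    exact norm_geom_sum_le (by rw [norm_pow, hc, one_pow]) _
  · set S := ∑ l ∈ Finset.range (m (k + 1)), (c ^ height m k) ^ l
    have h1 := h.norm_zeroWord_succ_sub_le hm hc hB k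
    have h2 := norm_le_norm_sub_add (F (zeroWord m (k + 1))) (S * F (zeroWord m k))
    rw [norm_mul] at h2
    have h3 : (m (k + 1) : ℝ) * height m k ≤ height m (k + 1) := by
      exact_mod_cast mul_height_le hm k
    have hpos : (0 : ℝ) < m (k + 1) * height m k := mul_pos (hmp k) (hd k)
    calc ‖F (zeroWord m (k + 1))‖ / height m (k + 1)
        ≤ ‖F (zeroWord m (k + 1))‖ / (m (k + 1) * height m k) :=
          div_le_div_of_nonneg_left (norm_nonneg _) hpos h3
      _ ≤ (‖S‖ * ‖F (zeroWord m k)‖ + (m (k + 1) * R + 3 * B * height m k)) /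
          (m (k + 1) * height m k) := div_le_div_of_nonneg_right (by linarith) hpos.le
      _ = _ := by
        have := (hd k).ne'
        have := (hmp k).ne'
        field_simp

/-- The increments of the averages are summable. One of the four B accounts for d_{k+1} - m_{k+1}
d_k ≤ d_k. -/
lemma IsQuasiAdditive.exists_tendsto (h : IsQuasiAdditive 1 F R B) (hm : Admissible m)
    (hB : 0 ≤ B) :
    ∃ z : ℂ, Tendsto (fun k => F (zeroWord m k) / height m k) atTop (nhds z) := by
  have hd : ∀ k, (0 : ℝ) < height m k := fun k => by exact_mod_cast height_pos hm k
  have hmp : ∀ k, (0 : ℝ) < m (k + 1) := fun k => by exact_mod_cast hm.pos k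
  refine cauchySeq_tendsto_of_complete (cauchySeq_of_dist_le_of_summable
    (fun k => R * (1 / (height m k : ℝ)) + 4 * B * (1 / (m (k + 1) : ℝ))) (fun k => ?_)
    (((summable_inv_height hm).mul_left _).add ((summable_inv_succ hm).mul_left _)))
  have h1 := h.norm_zeroWord_succ_sub_le hm norm_one hB k
  simp only [one_pow, Finset.sum_const, Finset.card_range, nsmul_eq_mul, mul_one] at h1
  set d : ℝ := (height m k : ℝ)
  set D : ℝ := (height m (k + 1) : ℝ)
  set M : ℝ := (m (k + 1) : ℝ)
  have h3 : M * d ≤ D := by simp only [M, d, D]; exact_mod_cast mul_height_le hm k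
  have h4 : D ≤ M * d + d := by simp only [M, d, D]; exact_mod_cast height_succ_le hm k
  have hd0 : (0 : ℝ) < d := hd k
  have hD0 : (0 : ℝ) < D := hd (k + 1)
  have hM0 : (0 : ℝ) < M := hmp k
  have hF : ‖F (zeroWord m k)‖ ≤ B * d := h.norm_le _
  have hdc : ((height m k : ℕ) : ℂ) = ((d : ℝ) : ℂ) := by simp [d]
  have hDc : ((height m (k + 1) : ℕ) : ℂ) = ((D : ℝ) : ℂ) := by simp [D]
  have hMc : ((m (k + 1) : ℕ) : ℂ) = ((M : ℝ) : ℂ) := by simp [M]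
  rw [hMc] at h1
  rw [dist_comm, dist_eq_norm, hdc, hDc]
  set u := F (zeroWord m k)
  set v := F (zeroWord m (k + 1))
  have hd1 : (d : ℂ) ≠ 0 := by exact_mod_cast hd0.ne'
  have hD1 : (D : ℂ) ≠ 0 := by exact_mod_cast hD0.ne'
  have h5 : v / D - u / d = ((v - M * u) - ((D - M * d : ℝ) : ℂ) / d * u) / D := by
    push_cast
    field_simp
    ring
  have h6 : ‖((D - M * d : ℝ) : ℂ) / d * u‖ ≤ B * d := by
    rw [norm_mul, norm_div, Complex.norm_real, Complex.norm_real, Real.norm_of_nonneg (by linarith),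
      Real.norm_of_nonneg hd0.le]
    have : (D - M * d) / d ≤ 1 := by rw [div_le_one hd0]; linarith
    calc _ ≤ 1 * ‖u‖ := mul_le_mul_of_nonneg_right this (norm_nonneg _)
      _ ≤ _ := by rw [one_mul]; exact hF
  have hMd : 0 < M * d := mul_pos hM0 hd0
  rw [h5, norm_div, Complex.norm_real, Real.norm_of_nonneg hD0.le]
  calc _ ≤ (M * R + 4 * B * d) / D := by
        refine div_le_div_of_nonneg_right ?_ hD0.le
        exact (norm_sub_le _ _).trans (by linarith)
    _ ≤ (M * R + 4 * B * d) / (M * d) := by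
        have := h.error_nonneg
        exact div_le_div_of_nonneg_left (by positivity) hMd h3
    _ = _ := by field_simp

lemma IsQuasiAdditive.sub_mul_length (h : IsQuasiAdditive 1 F R B) (z : ℂ) :
    IsQuasiAdditive 1 (fun w => F w - z * w.length) R (B + ‖z‖) where
  norm_le w := by
    refine (norm_sub_le _ _).trans ?_
    rw [norm_mul, Complex.norm_natCast]
    linarith [h.norm_le w]
  norm_append_le w w' := by
    convert h.norm_append_le w w' using 2
    rw [List.length_append]
    push_cast
    ring

/-- Uniform convergence of the twisted averages over factors. -/
lemma IsQuasiAdditive.exists_uniform (h : IsQuasiAdditive c F R B) (hm : Admissible m)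
    (hc : ‖c‖ = 1) (hB : 0 ≤ B) :
    ∃ z : ℂ, (c ≠ 1 → z = 0) ∧ ∀ ε : ℝ, 0 < ε →
      ∀ᶠ n : ℕ in atTop, ∀ i, ‖F (window (limitSeq m) i n) - z * n‖ ≤ ε * n := by
  by_cases hc1 : c = 1
  · subst hc1
    obtain ⟨z, hz⟩ := h.exists_tendsto hm hB
    refine ⟨z, fun h' => absurd rfl h', fun ε hε => ?_⟩
    have := (h.sub_mul_length z).eventually_norm_window_le hm hc ?_ hε
    · simpa only [length_window] using this
    · have h1 := (hz.sub_const z).norm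
      rw [sub_self, norm_zero] at h1
      refine h1.congr fun k => ?_
      have hd : (height m k : ℂ) ≠ 0 := by exact_mod_cast (height_pos hm k).ne'
      change _ = ‖F (zeroWord m k) - z * height m k‖ / height m k
      rw [← Complex.norm_natCast (height m k), ← norm_div, sub_div, mul_div_cancel_right₀ _ hd]
  · refine ⟨0, fun _ => rfl, fun ε hε => ?_⟩
    simpa using h.eventually_norm_window_le hm hc (h.tendsto_of_ne_one hm hc hc1 hB) hε

end QuasiAdditive

/-! ### Twisted Birkhoff sums on words. -/

section TwistedSums

variable {A : Type*} {c : ℂ} {g : List A → ℂ}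

/-- The sum of `g` over the final parts of a word, twisted by the powers of `c`. -/
def twistedSum (c : ℂ) (g : List A → ℂ) : List A → ℂ
  | [] => 0
  | a :: w => g (a :: w) + c * twistedSum c g w

lemma twistedSum_eq_sum (c : ℂ) (g : List A → ℂ) (w : List A) :
    twistedSum c g w = ∑ i ∈ Finset.range w.length, c ^ i * g (w.drop i) := by
  induction w with
  | nil => simp [twistedSum]
  | cons a w ih =>
    rw [twistedSum, ih, List.length_cons, Finset.sum_range_succ', Finset.mul_sum, add_comm]
    congr 1
    · refine Finset.sum_congr rfl fun i _ => ?_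
      rw [List.drop_succ_cons, pow_succ]; ring
    · simp

/-- Appending a word affects `g` only on final parts shorter than `R`, by at most 2 each. -/
lemma isQuasiAdditive_twistedSum (hc : ‖c‖ = 1) (hg : ∀ w, ‖g w‖ ≤ 1) {R : ℕ}
    (hR : ∀ w w', R ≤ w.length → g (w ++ w') = g w) :
    IsQuasiAdditive c (twistedSum c g) (2 * R) 1 where
  norm_le w := by
    induction w with
    | nil => simp [twistedSum]
    | cons a w ih =>
      rw [twistedSum, List.length_cons]
      refine (norm_add_le _ _).trans ?_
      rw [norm_mul, hc]
      push_cast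
      linarith [hg (a :: w)]
  norm_append_le w w' := by
    have key : ‖twistedSum c g (w ++ w') -
        (twistedSum c g w + c ^ w.length * twistedSum c g w')‖ ≤ 2 * (min w.length R : ℕ) := by
      induction w with
      | nil => simp [twistedSum]
      | cons a w ih =>
        have h1 : twistedSum c g (a :: w ++ w') -
            (twistedSum c g (a :: w) + c ^ (a :: w).length * twistedSum c g w') =
            (g (a :: w ++ w') - g (a :: w)) + c * (twistedSum c g (w ++ w') -
              (twistedSum c g w + c ^ w.length * twistedSum c g w')) := by
          rw [List.cons_append, twistedSum, twistedSum, List.length_cons, pow_succ]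
          ring
        rw [h1]
        refine (norm_add_le _ _).trans ?_
        rw [norm_mul, hc, one_mul]
        rcases le_or_gt R (a :: w).length with h | h
        · rw [hR _ _ h, sub_self, norm_zero, zero_add]
          refine ih.trans ?_
          have : min w.length R ≤ min (a :: w).length R :=
            min_le_min_right _ (by rw [List.length_cons]; omega)
          have : ((min w.length R : ℕ) : ℝ) ≤ (min (a :: w).length R : ℕ) := by exact_mod_cast this
          linarith
        · have h2 := (norm_sub_le (g (a :: w ++ w')) (g (a :: w))).trans
            (add_le_add (hg _) (hg _))
          rw [List.length_cons] at h
          rw [min_eq_left (by omega)] at ih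
          rw [List.length_cons, min_eq_left (by omega)]
          push_cast
          linarith
    refine key.trans ?_
    have : ((min w.length R : ℕ) : ℝ) ≤ R := by exact_mod_cast min_le_right _ _
    linarith

end TwistedSums

/-! ### Uniform twisted averages on the subshift. -/

section UniformAverages

variable {m : ℕ → ℕ}

/-- Uniform convergence of the twisted averages of functions of finitely many coordinates. -/
lemma exists_uniform_average (hm : Admissible m) {c : ℂ} (hc : ‖c‖ = 1)
    {φ : (ℤ → Fin 2) → ℂ} (hφ : ∀ x, ‖φ x‖ ≤ 1) {r : ℕ}
    (hr : ∀ x x' : ℤ → Fin 2, (∀ j : ℤ, -r ≤ j → j ≤ r → x j = x' j) → φ x = φ x') :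
    ∃ z : ℂ, (c ≠ 1 → z = 0) ∧ ∀ ε : ℝ, 0 < ε → ∀ᶠ n : ℕ in atTop,
      ∀ x ∈ (factorSubshift (limitSeq m)).carrier,
        ‖∑ i ∈ Finset.range n, c ^ i * φ (shift (i : ℤ) x) - z * n‖ ≤ ε * n := by
  -- The first letter sits at coordinate -r. The padding can affect `φ` only when fewer than 2r + 1
  -- letters remain.
  set pt : List (Fin 2) → ℤ → Fin 2 := fun w j => w.getD (j + r).toNat 0 with hpt
  set R := 2 * r + 1 with hR
  have hq := isQuasiAdditive_twistedSum (g := fun w => φ (pt w)) (R := R) hc (fun w => hφ _) (by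
    intro w w' hw
    refine hr _ _ fun j hj1 hj2 => ?_
    exact List.getD_append _ _ _ _ (by omega))
  obtain ⟨z, hz, h⟩ := hq.exists_uniform hm hc zero_le_one
  refine ⟨z, hz, fun ε hε => ?_⟩
  obtain ⟨N, hN⟩ := exists_nat_ge (2 * R / (ε / 2))
  filter_upwards [h (ε / 2) (half_pos hε), eventually_ge_atTop N] with n hn hNn x hx
  obtain ⟨i', hi'⟩ := hx (-r) n
  have h1 := hn i'
  set w := window (limitSeq m) i' n with hw
  have hwlen : w.length = n := length_window _ _ _
  have hwx : ∀ j < n, w.getD j 0 = x (-r + j) := by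
    intro j hj
    rw [hi' j hj, List.getD_eq_getElem _ _ (by omega)]
    simp [hw, window, factor]
  have h2 : ‖∑ i ∈ Finset.range n, c ^ i * φ (shift (i : ℤ) x) -
      twistedSum c (fun w => φ (pt w)) w‖ ≤ 2 * R := by
    rw [twistedSum_eq_sum, hwlen, ← Finset.sum_sub_distrib]
    have h3 : ∀ i ∈ Finset.range n, ‖c ^ i * φ (shift (i : ℤ) x) - c ^ i * φ (pt (w.drop i))‖ ≤
        if i ∈ Finset.Ico (n - R) n then 2 else 0 := by
      intro i hi
      rw [Finset.mem_range] at hi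
      split_ifs with h4
      · rw [← mul_sub, norm_mul, norm_pow, hc, one_pow, one_mul]
        refine (norm_sub_le _ _).trans ?_
        linarith [hφ (shift (i : ℤ) x), hφ (pt (w.drop i))]
      · rw [Finset.mem_Ico] at h4
        rw [hr (shift (i : ℤ) x) (pt (w.drop i)), sub_self, norm_zero]
        intro j hj1 hj2
        rw [hpt]
        simp only
        rw [List.getD_eq_getElem?_getD, List.getElem?_drop, ← List.getD_eq_getElem?_getD,
          hwx _ (by omega), shift_apply]
        congr 1
        omega
    refine (norm_sum_le_of_le _ h3).trans ?_
    rw [Finset.sum_ite_mem, Finset.sum_const, nsmul_eq_mul]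
    have h5 : (Finset.range n ∩ Finset.Ico (n - R) n).card ≤ R :=
      (Finset.card_le_card Finset.inter_subset_right).trans (by rw [Nat.card_Ico]; omega)
    have h6 : ((Finset.range n ∩ Finset.Ico (n - R) n).card : ℝ) ≤ R := by exact_mod_cast h5
    linarith
  have h7 : 2 * (R : ℝ) ≤ ε / 2 * n := by
    have : (N : ℝ) ≤ n := by exact_mod_cast hNn
    have := hN.trans this
    rw [div_le_iff₀ (half_pos hε)] at this
    linarith
  have h8 := norm_sub_le_norm_sub_add_norm_sub
    (∑ i ∈ Finset.range n, c ^ i * φ (shift (i : ℤ) x)) (twistedSum c (fun w => φ (pt w)) w)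
    (z * n)
  linarith

end UniformAverages

/-! ### Existence of an invariant measure. -/

section InvariantMeasures

variable {X : Subshift (Fin 2) ℤ}

lemma continuous_shiftMap (X : Subshift (Fin 2) ℤ) : Continuous (shiftMap X) :=
  Continuous.subtype_mk ((continuous_shift 1).comp continuous_subtype_val) _

lemma measurable_shiftMap (X : Subshift (Fin 2) ℤ) : Measurable (shiftMap X) := by
  refine Measurable.subtype_mk ?_
  refine measurable_pi_lambda _ fun j => ?_
  exact (measurable_pi_apply _).comp measurable_subtype_coe

lemma coe_iterate_shiftMap (x : X.carrier) (i : ℕ) :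
    (((shiftMap X)^[i] x : X.carrier) : ℤ → Fin 2) = shift (i : ℤ) (x : ℤ → Fin 2) := by
  induction i with
  | zero => simp
  | succ i ih =>
    rw [Function.iterate_succ_apply']
    change shift (1 : ℤ) (((shiftMap X)^[i] x : X.carrier) : ℤ → Fin 2) = _
    rw [ih, ← shift_add]
    push_cast
    rfl

instance (X : Subshift (Fin 2) ℤ) : CompactSpace X.carrier :=
  isCompact_iff_compactSpace.1 X.isClosed.isCompact

/-- Krylov–Bogolyubov: a nonempty subshift carries an invariant probability measure. -/
theorem exists_isInvariantProbability (X : Subshift (Fin 2) ℤ) (x₀ : X.carrier) :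
    ∃ μ : Measure X.carrier, IsInvariantProbability X μ := by
  set T := shiftMap X with hT
  have hTc : Continuous T := continuous_shiftMap X
  have hTm : Measurable T := measurable_shiftMap X
  set ν : ℕ → Measure X.carrier := fun n =>
    ((n + 1 : ℕ) : ENNReal)⁻¹ • ∑ i ∈ Finset.range (n + 1), Measure.dirac (T^[i] x₀) with hν
  have hprob : ∀ n, IsProbabilityMeasure (ν n) := fun n => ⟨by
    simp only [hν, Measure.smul_apply, Measure.finsetSum_apply, measure_univ, Finset.sum_const,
      Finset.card_range, smul_eq_mul, nsmul_eq_mul, mul_one]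
    exact ENNReal.inv_mul_cancel (by simp) (by simp)⟩
  have hint : ∀ n (f : X.carrier → ℝ), Continuous f →
      ∫ x, f x ∂(ν n) = (n + 1 : ℝ)⁻¹ * ∑ i ∈ Finset.range (n + 1), f (T^[i] x₀) := by
    intro n f hf
    simp only [hν]
    rw [integral_smul_measure, integral_finsetSum_measure]
    · rw [ENNReal.toReal_inv, ENNReal.toReal_natCast]
      simp only [integral_dirac, smul_eq_mul]
      push_cast
      rfl
    · intro i _
      exact integrable_dirac (by simp)
  set p : ℕ → ProbabilityMeasure X.carrier := fun n => ⟨ν n, hprob n⟩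
  -- Compactness of the space of probability measures gives this ultrafilter a limit; telescoping
  -- makes the limit invariant.
  set U : Ultrafilter (ProbabilityMeasure X.carrier) := (hyperfilter ℕ).map p
  have hlim : Tendsto p (hyperfilter ℕ) (nhds U.lim) := U.le_nhds_lim
  set μ : ProbabilityMeasure X.carrier := U.lim
  refine ⟨μ, inferInstance, hTm, ?_⟩
  have hmap : IsFiniteMeasure ((μ : Measure X.carrier).map T) :=
    Measure.isFiniteMeasure_map _ _
  refine ext_of_forall_integral_eq_of_IsFiniteMeasure fun f => ?_
  rw [integral_map hTm.aemeasurable f.continuous.aestronglyMeasurable]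
  set f' : BoundedContinuousFunction X.carrier ℝ := f.compContinuous ⟨T, hTc⟩
  have h1 := (ProbabilityMeasure.tendsto_iff_forall_integral_tendsto.1 hlim) f
  have h2 := (ProbabilityMeasure.tendsto_iff_forall_integral_tendsto.1 hlim) f'
  have h3 : Tendsto (fun n => ∫ x, f' x ∂(p n : Measure X.carrier) -
      ∫ x, f x ∂(p n : Measure X.carrier)) (hyperfilter ℕ) (nhds 0) := by
    have h4 : Tendsto (fun n : ℕ => (1 / ((n : ℝ) + 1)) * (2 * ‖f‖)) atTop (nhds 0) := by
      simpa using tendsto_one_div_add_atTop_nhds_zero_nat.mul_const (2 * ‖f‖)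
    refine squeeze_zero_norm (fun n => ?_) (h4.mono_left
      (by rw [← Nat.cofinite_eq_atTop]; exact hyperfilter_le_cofinite))
    change ‖∫ x, f' x ∂(ν n) - ∫ x, f x ∂(ν n)‖ ≤ _
    rw [hint n _ f'.continuous, hint n _ f.continuous, ← mul_sub, norm_mul, one_div,
      Real.norm_of_nonneg (by positivity)]
    refine mul_le_mul_of_nonneg_left ?_ (by positivity)
    have h5 : ∀ i, f' (T^[i] x₀) = f (T^[i + 1] x₀) := fun i => by
      rw [Function.iterate_succ_apply']; rfl
    simp only [h5]
    rw [← Finset.sum_sub_distrib, Finset.sum_range_sub (fun i => f (T^[i] x₀))]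
    refine (norm_sub_le _ _).trans ?_
    linarith [f.norm_coe_le_norm (T^[n + 1] x₀), f.norm_coe_le_norm (T^[0] x₀)]
  exact sub_eq_zero.1 (tendsto_nhds_unique (h2.sub h1) h3)

end InvariantMeasures

/-! ### Reduction to bounded eigenfunctions of unimodular eigenvalues. -/

section Eigenfunctions

variable {Ω : Type*} [MeasurableSpace Ω] {μ : Measure Ω} {T : Ω → Ω}

/-- An eigenfunction of a measure preserving map for an eigenvalue of modulus different from one
vanishes almost everywhere. -/
lemma ae_eq_zero_of_norm_ne_one [IsFiniteMeasure μ] (hT : MeasurePreserving T μ μ) {c : ℂ}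
    (hc : ‖c‖ ≠ 1) {f : Ω → ℂ} (hf : AEStronglyMeasurable f μ)
    (h : ∀ᵐ x ∂μ, f (T x) = c * f x) : ∀ᵐ x ∂μ, f x = 0 := by
  -- A bounded, strictly increasing function of the modulus: its integral exists and is invariant
  -- even if `f` is not integrable.
  set ψ : ℂ → ℝ := fun z => ‖z‖ / (1 + ‖z‖) with hψ
  have hψc : Continuous ψ :=
    continuous_norm.div (continuous_const.add continuous_norm) fun z => by positivity
  have hψm : AEStronglyMeasurable (fun x => ψ (f x)) μ := hψc.comp_aestronglyMeasurable hf
  have hψb : ∀ z, ‖ψ z‖ ≤ 1 := fun z => by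
    rw [Real.norm_of_nonneg (by positivity)]
    exact (div_le_one (by positivity)).2 (by linarith)
  have hi1 : Integrable (fun x => ψ (f x)) μ :=
    Integrable.of_bound hψm 1 (Eventually.of_forall fun x => hψb _)
  have hi2 : Integrable (fun x => ψ (f (T x))) μ := hT.integrable_comp_of_integrable hi1
  have heq : ∫ x, ψ (f (T x)) ∂μ = ∫ x, ψ (f x) ∂μ := by
    have := integral_map (μ := μ) hT.measurable.aemeasurable (f := fun x => ψ (f x))
      (by rw [hT.map_eq]; exact hψm)
    rw [hT.map_eq] at this
    exact this.symm
  have hmono : ∀ a b : ℝ, 0 ≤ a → a ≤ b → a / (1 + a) ≤ b / (1 + b) := by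
    intro a b ha hab
    rw [div_le_div_iff₀ (by linarith) (by linarith)]
    nlinarith
  have hae : ∀ᵐ x ∂μ, ψ (f (T x)) = ψ (f x) := by
    rcases lt_or_gt_of_ne hc with hlt | hgt
    · refine (integral_eq_iff_of_ae_le hi2 hi1 ?_).1 heq
      filter_upwards [h] with x hx
      refine hmono _ _ (norm_nonneg _) ?_
      rw [hx, norm_mul]
      nlinarith [norm_nonneg (f x)]
    · refine ((integral_eq_iff_of_ae_le hi1 hi2 ?_).1 heq.symm).symm
      filter_upwards [h] with x hx
      refine hmono _ _ (norm_nonneg _) ?_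
      rw [hx, norm_mul]
      nlinarith [norm_nonneg (f x)]
  filter_upwards [h, hae] with x hx hx'
  simp only [hψ] at hx'
  rw [div_eq_div_iff (by positivity) (by positivity), hx, norm_mul] at hx'
  have h1 : (‖c‖ - 1) * ‖f x‖ = 0 := by linarith
  exact norm_eq_zero.1 ((mul_eq_zero.1 h1).resolve_left (sub_ne_zero.2 hc))

/-- It suffices to treat bounded eigenfunctions. -/
lemma exists_ae_eq_const_of_bounded [NeZero μ] {c : ℂ} (hc : ‖c‖ = 1)
    (hbdd : ∀ f : Ω → ℂ, AEStronglyMeasurable f μ → (∃ M : ℝ, ∀ x, ‖f x‖ ≤ M) →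
      (∀ᵐ x ∂μ, f (T x) = c * f x) → ∃ z : ℂ, ∀ᵐ x ∂μ, f x = z)
    {f : Ω → ℂ} (hf : AEStronglyMeasurable f μ) (h : ∀ᵐ x ∂μ, f (T x) = c * f x) :
    ∃ z : ℂ, ∀ᵐ x ∂μ, f x = z := by
  classical
  -- Truncation by modulus commutes with multiplication by the unimodular `c`.
  set ψ : ℕ → ℂ → ℂ := fun M z => if ‖z‖ ≤ M then z else 0 with hψ
  have hψm : ∀ M, Measurable (ψ M) := fun M =>
    Measurable.ite (measurableSet_le measurable_norm measurable_const) measurable_id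
      measurable_const
  have key : ∀ M, ∃ z, ∀ᵐ x ∂μ, ψ M (f x) = z := by
    intro M
    refine hbdd _ ((hψm M).comp_aemeasurable hf.aemeasurable).aestronglyMeasurable
      ⟨M, fun x => ?_⟩ ?_
    · simp only [hψ]
      split_ifs with h1
      · exact h1
      · simp
    · filter_upwards [h] with x hx
      simp only [hψ]
      rw [hx, norm_mul, hc, one_mul]
      split_ifs <;> simp
  choose z hz using key
  have hall := ae_all_iff.2 hz
  obtain ⟨x₀, hx₀⟩ := hall.exists
  refine ⟨f x₀, hall.mono fun x hx => ?_⟩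
  obtain ⟨M, hM⟩ := exists_nat_ge (max ‖f x‖ ‖f x₀‖)
  have h1 : ψ M (f x) = f x := if_pos ((le_max_left _ _).trans hM)
  have h2 : ψ M (f x₀) = f x₀ := if_pos ((le_max_right _ _).trans hM)
  rw [← h1, ← h2, hx, hx₀]

end Eigenfunctions

/-! ### Unique ergodicity and weak mixing. -/

section UniqueErgodicity

variable {m : ℕ → ℕ}

/-- A measurable cylinder depends on finitely many coordinates only. -/
lemma exists_radius_of_mem_measurableCylinders {s : Set (ℤ → Fin 2)}
    (hs : s ∈ measurableCylinders fun _ : ℤ => Fin 2) :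
    ∃ r : ℕ, ∀ x x' : ℤ → Fin 2, (∀ j : ℤ, -r ≤ j → j ≤ r → x j = x' j) →
      s.indicator (1 : (ℤ → Fin 2) → ℂ) x = s.indicator 1 x' := by
  obtain ⟨I, S, -, rfl⟩ := (mem_measurableCylinders _).1 hs
  refine ⟨I.sup Int.natAbs, fun x x' h => ?_⟩
  have h1 : I.restrict x = I.restrict x' := by
    funext j
    have := Finset.le_sup (f := Int.natAbs) j.2
    exact h j (by omega) (by omega)
  have h2 : x ∈ MeasureTheory.cylinder I S ↔ x' ∈ MeasureTheory.cylinder I S := by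
    rw [MeasureTheory.mem_cylinder, MeasureTheory.mem_cylinder, h1]
  by_cases hx : x ∈ MeasureTheory.cylinder I S
  · rw [Set.indicator_of_mem hx, Set.indicator_of_mem (h2.1 hx)]
    rfl
  · rw [Set.indicator_of_notMem hx, Set.indicator_of_notMem (h2.not.1 hx)]

/-- The integral of an eigenfunction over a cylinder is determined by the uniform averages. -/
lemma exists_setIntegral_eq (hm : Admissible m) {c : ℂ} (hc : ‖c‖ = 1) {s : Set (ℤ → Fin 2)}
    (hs : s ∈ measurableCylinders fun _ : ℤ => Fin 2) :
    ∃ z : ℂ, (c ≠ 1 → z = 0) ∧ ∀ (μ : Measure (factorSubshift (limitSeq m)).carrier),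
      IsInvariantProbability (factorSubshift (limitSeq m)) μ →
      ∀ f : (factorSubshift (limitSeq m)).carrier → ℂ, Integrable f μ →
        (∀ᵐ x ∂μ, f (shiftMap _ x) = c * f x) →
        ∫ x in Subtype.val ⁻¹' s, f x ∂μ = z * ∫ x, f x ∂μ := by
  obtain ⟨r, hr⟩ := exists_radius_of_mem_measurableCylinders hs
  set φ : (ℤ → Fin 2) → ℂ := s.indicator 1 with hφ
  have hsm : MeasurableSet s := MeasurableSet.of_mem_measurableCylinders hs
  have hφm : Measurable φ := measurable_one.indicator hsm
  have hφb : ∀ x, ‖φ x‖ ≤ 1 := fun x => by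
    by_cases hx : x ∈ s <;> simp [hφ, hx]
  obtain ⟨z, hz, hlim⟩ := exists_uniform_average hm hc hφb hr
  refine ⟨z, hz, fun μ hμ f hf hfc => ?_⟩
  obtain ⟨hprob, hT⟩ := hμ
  set T := shiftMap (factorSubshift (limitSeq m))
  have hiter : ∀ i : ℕ, ∀ᵐ x ∂μ, f (T^[i] x) = c ^ i * f x := by
    intro i
    induction i with
    | zero => simp
    | succ i ih =>
      filter_upwards [hT.quasiMeasurePreserving.ae ih, hfc] with x h1 h2
      rw [Function.iterate_succ_apply, h1, h2, pow_succ]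
      ring
  have hset : ∫ x in Subtype.val ⁻¹' s, f x ∂μ = ∫ x, φ (x : ℤ → Fin 2) * f x ∂μ := by
    rw [← integral_indicator (measurable_subtype_coe hsm)]
    refine integral_congr_ae (Eventually.of_forall fun x => ?_)
    by_cases hx : (x : ℤ → Fin 2) ∈ s
    · simp only [hφ]
      rw [Set.indicator_of_mem (show x ∈ Subtype.val ⁻¹' s from hx), Set.indicator_of_mem hx]
      simp
    · simp only [hφ]
      rw [Set.indicator_of_notMem (show x ∉ Subtype.val ⁻¹' s from hx),
        Set.indicator_of_notMem hx, zero_mul]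
  have hint : ∀ i : ℕ, Integrable (fun x : (factorSubshift (limitSeq m)).carrier =>
      φ (shift (i : ℤ) (x : ℤ → Fin 2)) * f x) μ := by
    intro i
    refine hf.bdd_mul (c := 1) ?_ (Eventually.of_forall fun x => hφb _)
    refine (hφm.comp ?_).aestronglyMeasurable
    exact measurable_pi_lambda _ fun j => (measurable_pi_apply _).comp measurable_subtype_coe
  -- Since c^i f = f ∘ T^i almost everywhere, invariance makes all these integrals equal; their mean
  -- is therefore governed by the uniform twisted average.
  have hterm : ∀ i : ℕ, ∫ x : (factorSubshift (limitSeq m)).carrier, c ^ i *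
      (φ (shift (i : ℤ) (x : ℤ → Fin 2)) * f x) ∂μ = ∫ x, φ (x : ℤ → Fin 2) * f x ∂μ := by
    intro i
    have h0 : Integrable (fun x : (factorSubshift (limitSeq m)).carrier =>
      φ (x : ℤ → Fin 2) * f x) μ := by simpa using hint 0
    have h1 := integral_map (μ := μ) (hT.iterate i).measurable.aemeasurable
      (f := fun x : (factorSubshift (limitSeq m)).carrier => φ (x : ℤ → Fin 2) * f x)
      (by rw [(hT.iterate i).map_eq]; exact h0.aestronglyMeasurable)
    rw [(hT.iterate i).map_eq] at h1
    rw [h1]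
    refine integral_congr_ae ?_
    filter_upwards [hiter i] with x hx
    rw [coe_iterate_shiftMap, hx]
    ring
  have hsum : ∀ n : ℕ, (n : ℂ) * ∫ x in Subtype.val ⁻¹' s, f x ∂μ - n * (z * ∫ x, f x ∂μ) =
      ∫ x, (∑ i ∈ Finset.range n, c ^ i * φ (shift (i : ℤ) (x : ℤ → Fin 2)) - z * n) * f x ∂μ := by
    intro n
    have h1 : ∀ x : (factorSubshift (limitSeq m)).carrier,
        (∑ i ∈ Finset.range n, c ^ i * φ (shift (i : ℤ) (x : ℤ → Fin 2)) - z * n) * f x =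
        ∑ i ∈ Finset.range n, c ^ i * (φ (shift (i : ℤ) (x : ℤ → Fin 2)) * f x) - z * n * f x := by
      intro x
      rw [sub_mul, Finset.sum_mul]
      simp only [mul_assoc]
    simp only [h1]
    rw [integral_sub (integrable_finsetSum _ fun i _ => (hint i).const_mul _) (hf.const_mul _),
      integral_finsetSum _ fun i _ => (hint i).const_mul _, integral_const_mul]
    simp only [hterm, Finset.sum_const, Finset.card_range, nsmul_eq_mul]
    rw [hset]
    ring
  set I := ∫ x in Subtype.val ⁻¹' s, f x ∂μ
  set J := ∫ x, f x ∂μ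
  refine sub_eq_zero.1 (norm_le_zero_iff.1 (le_of_forall_pos_le_add fun ε hε => ?_))
  set C := ∫ x, ‖f x‖ ∂μ with hC
  have hC0 : 0 ≤ C := integral_nonneg fun x => norm_nonneg _
  obtain ⟨n, hn, hn0⟩ := ((hlim (ε / (C + 1)) (by positivity)).and (eventually_gt_atTop 0)).exists
  have hn0' : (0 : ℝ) < n := by exact_mod_cast hn0
  have h2 : ‖(n : ℂ) * I - n * (z * J)‖ ≤ ε / (C + 1) * n * C := by
    rw [hsum n, hC, ← integral_const_mul]
    refine norm_integral_le_of_norm_le (hf.norm.const_mul _) (Eventually.of_forall fun x => ?_)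
    rw [norm_mul]
    exact mul_le_mul_of_nonneg_right (hn x x.2) (norm_nonneg _)
  rw [← mul_sub, norm_mul, Complex.norm_natCast] at h2
  have h3 : ε / (C + 1) * C ≤ ε := by
    rw [div_mul_eq_mul_div, div_le_iff₀ (by positivity)]
    nlinarith
  rw [zero_add]
  refine le_trans ?_ h3
  refine le_of_mul_le_mul_left ?_ hn0'
  linarith

lemma measurableSpace_carrier_eq (X : Subshift (Fin 2) ℤ) :
    (inferInstance : MeasurableSpace X.carrier) = MeasurableSpace.generateFrom
      (Set.preimage Subtype.val '' measurableCylinders fun _ : ℤ => Fin 2) := by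
  rw [← MeasurableSpace.comap_generateFrom, generateFrom_measurableCylinders]
  rfl

lemma isPiSystem_preimage_measurableCylinders (X : Subshift (Fin 2) ℤ) :
    IsPiSystem (Set.preimage (Subtype.val : X.carrier → ℤ → Fin 2) ''
      measurableCylinders fun _ : ℤ => Fin 2) := by
  rintro _ ⟨s, hs, rfl⟩ _ ⟨t, ht, rfl⟩ -
  exact ⟨s ∩ t, inter_mem_measurableCylinders hs ht, rfl⟩

/-- For c = 1 and f = 1, the measure of a cylinder is the constant `z`, which does not depend on the
measure. -/
theorem eq_of_isInvariantProbability (hm : Admissible m)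
    {μ ν : Measure (factorSubshift (limitSeq m)).carrier}
    (hμ : IsInvariantProbability (factorSubshift (limitSeq m)) μ)
    (hν : IsInvariantProbability (factorSubshift (limitSeq m)) ν) : ν = μ := by
  have := hμ.1
  have := hν.1
  refine ext_of_generate_finite _ (measurableSpace_carrier_eq _)
    (isPiSystem_preimage_measurableCylinders _) ?_ (by simp)
  rintro _ ⟨s, hs, rfl⟩
  obtain ⟨z, -, h⟩ := exists_setIntegral_eq hm (c := 1) norm_one hs
  have h1 := h μ hμ (fun _ => 1) (integrable_const _) (by simp)
  have h2 := h ν hν (fun _ => 1) (integrable_const _) (by simp)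
  simp only [integral_const, probReal_univ, one_smul, mul_one, measureReal_restrict_apply,
    MeasurableSet.univ, Set.univ_inter] at h1 h2
  have h3 := h2.trans h1.symm
  simp only [Complex.real_smul, mul_one, Complex.ofReal_inj] at h3
  exact (measureReal_eq_measureReal_iff).1 h3

theorem isWeakMixing_of_isInvariantProbability (hm : Admissible m)
    {μ : Measure (factorSubshift (limitSeq m)).carrier}
    (hμ : IsInvariantProbability (factorSubshift (limitSeq m)) μ) :
    IsWeakMixing (shiftMap (factorSubshift (limitSeq m))) μ := by
  intro c f hf hfc
  have hprob := hμ.1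
  by_cases hc : ‖c‖ = 1
  swap
  · exact ⟨0, ae_eq_zero_of_norm_ne_one hμ.2 hc hf hfc⟩
  refine exists_ae_eq_const_of_bounded hc (fun f hf hb hfc => ?_) hf hfc
  obtain ⟨M, hM⟩ := hb
  have hfi : Integrable f μ := Integrable.of_bound hf M (Eventually.of_forall hM)
  set J := ∫ x, f x ∂μ
  set z : ℂ := if c = 1 then J else 0 with hz
  -- On cylinders, c ≠ 1 gives integral 0, while c = 1 gives μ(s) J by comparing `f` with the
  -- constant 1. The π-λ theorem extends this to all measurable sets.
  have key : ∀ s, MeasurableSet s → ∫ x in s, f x ∂μ = ∫ x in s, z ∂μ := by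
    intro s hs
    induction s, hs using MeasurableSpace.induction_on_inter (measurableSpace_carrier_eq _)
      (isPiSystem_preimage_measurableCylinders _) with
    | empty => simp
    | basic t ht =>
      obtain ⟨s, hs, rfl⟩ := ht
      by_cases hc1 : c = 1
      · subst hc1
        obtain ⟨w, -, h⟩ := exists_setIntegral_eq hm (c := 1) norm_one hs
        have h1 := h μ hμ f hfi hfc
        have h2 := h μ hμ (fun _ => 1) (integrable_const _) (by simp)
        rw [h1]
        simp only [integral_const, probReal_univ, one_smul, mul_one,
          measureReal_restrict_apply, MeasurableSet.univ, Set.univ_inter] at h2 ⊢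
        rw [← h2, hz, if_pos rfl]
        simp [J]
      · obtain ⟨w, hw, h⟩ := exists_setIntegral_eq hm hc hs
        rw [h μ hμ f hfi hfc, hw hc1, hz, if_neg hc1]
        simp
    | compl t ht ih =>
      have huniv : ∫ x, f x ∂μ = ∫ x, z ∂μ := by
        have hcyl : (Set.univ : Set (ℤ → Fin 2)) ∈ measurableCylinders fun _ : ℤ => Fin 2 :=
          univ_mem_measurableCylinders _
        by_cases hc1 : c = 1
        · rw [hz, if_pos hc1]; simp [J]
        · obtain ⟨w, hw, h⟩ := exists_setIntegral_eq hm hc hcyl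
          have h1 := h μ hμ f hfi hfc
          rw [hw hc1, Set.preimage_univ, setIntegral_univ, zero_mul] at h1
          rw [h1, hz, if_neg hc1]; simp
      rw [setIntegral_compl ht hfi, setIntegral_compl ht (integrable_const _), ih, huniv]
    | iUnion g hd hg ih =>
      rw [integral_iUnion hg hd hfi.integrableOn, integral_iUnion hg hd
        (integrable_const _).integrableOn]
      exact tsum_congr ih
  exact ⟨z, Integrable.ae_eq_of_forall_setIntegral_eq f (fun _ => z) hfi (integrable_const _)
    fun s hs _ => key s hs⟩

end UniqueErgodicity

end LowComplexity

theorem theorem3p1 :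
    ∃ (m n : ℕ → ℕ) (y : ℕ → Fin 2) (X : SymbolicDynamics.FullShift.Subshift (Fin 2) ℤ),
      -- the parameters: `m 1 = 1 < m 2 < m 3 < ⋯`, `n k = 2 * m k`, and prime tower heights
      m 1 = 1 ∧ StrictMonoOn m (Set.Ici 1) ∧ (∀ k, 1 ≤ k → n k = 2 * m k) ∧
      Summable (fun k : ℕ => (1 : ℝ) / m k) ∧
      (∀ k, 2 ≤ k → (LowComplexity.rho m n k 0).length.Prime) ∧
      -- the subshift that they generate
      LowComplexity.IsLimitOfWords (fun k => LowComplexity.rho m n k 0) y ∧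
      LowComplexity.IsOrbitClosureOfOneSided X y ∧
      -- its properties
      X.carrier.Infinite ∧
      LowComplexity.IsTransitive X ∧
      (∃ μ : MeasureTheory.Measure X.carrier,
        LowComplexity.IsInvariantProbability X μ ∧
        (∀ ν : MeasureTheory.Measure X.carrier,
          LowComplexity.IsInvariantProbability X ν → ν = μ) ∧
        LowComplexity.IsWeakMixing (LowComplexity.shiftMap X) μ) ∧
      Filter.limsup
        (fun q : ℕ => (((LowComplexity.complexity X q : ℝ) / (q : ℝ) : ℝ) : EReal))
        Filter.atTop = ((3 / 2 : ℝ) : EReal) := by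
  obtain ⟨m, hm, hmono⟩ := LowComplexity.exists_admissible
  have hx := LowComplexity.twoSidedSeq_mem hm
  obtain ⟨μ, hμ⟩ := LowComplexity.exists_isInvariantProbability
    (LowComplexity.factorSubshift (LowComplexity.limitSeq m)) ⟨_, hx⟩
  exact ⟨m, fun k => 2 * m k, LowComplexity.limitSeq m,
    LowComplexity.factorSubshift (LowComplexity.limitSeq m), hm.one, hmono, fun _ _ => rfl,
    hm.summable, hm.prime, LowComplexity.isLimitOfWords_limitSeq hm,
    LowComplexity.isOrbitClosureOfOneSided_factorSubshift hm,
    LowComplexity.infinite_factorSubshift hm,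
    ⟨_, hx, LowComplexity.isMinimal_factorSubshift hm _ hx⟩,
    ⟨μ, hμ, fun _ hν => LowComplexity.eq_of_isInvariantProbability hm hμ hν,
      LowComplexity.isWeakMixing_of_isInvariantProbability hm hμ⟩,
    LowComplexity.limsup_complexity_div hm⟩
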